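/- Let $E$ be an elliptic curve over a number field $K$, let $p$ be a prime number, let $n\ge 1$, and let $P\in E(K)$ be a point of exact order $p^n$. Let $\mathfrak p$ be a prime of $K$ above $p$ at which $E$ has good supersingular reduction. For a prime $\mathfrak P$ of the division field $K(E[p^n])$ lying above $\mathfrak p$, let $e_{\mathfrak p}$ and $e_{\mathfrak P}$ be the ramification indices of $\mathfrak p$ and $\mathfrak P$ over $p$. Fix a Weierstrass equation $y^2+a_1xy+a_3y=x^3+a_2x^2+a_4x+a_6$ of $E$ over $K$ that is minimal at $\mathfrak p$. Let $v$ be the $\mathfrak p$-adic valuation on $K$ normalized by $v(p)=1$ (with $v(0)=\infty$), extended to an algebraic closure $\overline K$. For a point $Q\neq O$ in the kernel of reduction put $\hat Q=-x(Q)/y(Q)$. We say that $E$ has a canonical subgroup at $\mathfrak p$ if there are points $R,Q\in E(\overline K)$ of exact order $p$ in the kernel of reduction with $v(\hat R)>v(\hat Q)$; the canonical subgroup is then $\langle R\rangle$. (Whether this holds does not depend on the extension of $v$.) Let $\mu$ be the valuation $v$ of the coefficient of $x^{(p^2-p)/2}$ in the $p$-th division polynomial of the chosen equation if $p$ is odd,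 and let $\mu=v(a_1^2+4a_2)/2$ if $p=2$. Then $E$ has a canonical subgroup at $\mathfrak p$ if and only if $\mu<\frac{p}{p+1}$, and the following hold. (1) For every $\mathfrak P$ above $\mathfrak p$, $e_{\mathfrak P}\ge p^{2n}-p^{2n-2}$; and $e_{\mathfrak p}>\varphi(p^n)=p^n-p^{n-1}$. (2) If $E$ does not have a canonical subgroup at $\mathfrak p$, then $p^{2n}-p^{2n-2}$ divides $e_{\mathfrak p}$. (3) If $E$ has a canonical subgroup at $\mathfrak p$, then $e_{\mathfrak P}>p^{2n}-p^{2n-2}$ for every $\mathfrak P$ above $\mathfrak p$. -/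

import Mathlib

open NumberField IsDedekindDomain

noncomputable section

namespace SupersingularTorsion

variable {K : Type*} [Field K] [NumberField K]

/-- The valuation ring `𝒪_{K,𝔭}` of `K` at the prime `𝔭`. -/
abbrev localRing (𝔭 : HeightOneSpectrum (𝓞 K)) : ValuationSubring K :=
  (𝔭.valuation K).valuationSubring

instance isDiscreteValuationRing_localRing (𝔭 : HeightOneSpectrum (𝓞 K)) :
    IsDiscreteValuationRing (localRing 𝔭) :=
  inferInstanceAs (IsDiscreteValuationRing (𝔭.valuation K).integer)

open scoped Classical in
/-- A curve over a field `k` of characteristic `p` is supersingular if it has no point of order `p`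
over an algebraic closure of `k`. -/
def IsSupersingular {k : Type*} [Field k] (p : ℕ) (W : WeierstrassCurve k) : Prop :=
  ∀ P : (W.baseChange (AlgebraicClosure k)).toAffine.Point, p • P = 0 → P = 0

/-- The Weierstrass equation `W` is minimal at the prime `𝔭` above `p`, and its reduction modulo `𝔭`
is a smooth supersingular curve over the residue field. An elliptic curve over `K` has good
supersingular reduction at `𝔭` when one (equivalently, each) of its Weierstrass equations that are
minimal at `𝔭` has this property. -/
def HasSupersingularReduction (W : WeierstrassCurve K) (𝔭 : HeightOneSpectrum (𝓞 K)) (p : ℕ) :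
    Prop :=
  ∃ _h : W.IsMinimal (localRing 𝔭),
    W.HasGoodReduction (localRing 𝔭) ∧ IsSupersingular p (W.reduction (localRing 𝔭))

open scoped Classical in
/-- The division field `K(E[m])`: the subfield of an algebraic closure of `K` generated over `K` by
the affine coordinates of all points of `E` killed by `m`. -/
def divisionField (E : WeierstrassCurve K) (m : ℕ) : IntermediateField K (AlgebraicClosure K) :=
  IntermediateField.adjoin K
    {a | ∃ (x y : AlgebraicClosure K)
      (h : (E.baseChange (AlgebraicClosure K)).toAffine.Nonsingular x y),
      m • (WeierstrassCurve.Affine.Point.some x y h) = 0 ∧ (a = x ∨ a = y)}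

section Points

variable {F : Type*} [Field F] {W : WeierstrassCurve F}

/-- The parameter `Q̂ = -x(Q)/y(Q)` of a point, where the point at infinity has parameter `0`. -/
def formalParam : W.toAffine.Point → F
  | .zero => 0
  | .some x y _ => -x / y

/-- For an equation with coefficients in the valuation ring `A`, the points reducing to the point
at infinity modulo the maximal ideal of `A`. -/
def InKernelOfReduction (A : ValuationSubring F) : W.toAffine.Point → Prop
  | .zero => True
  | .some x _ _ => x ∉ A

open scoped Classical in
/-- `Ê[=p]`: the points of exact order `p` in the kernel of reduction. -/
def formalTorsion (A : ValuationSubring F) (W : WeierstrassCurve F) (p : ℕ) :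
    Set W.toAffine.Point :=
  {Q | InKernelOfReduction A Q ∧ addOrderOf Q = p}

open scoped Classical in
/-- `C` is the canonical subgroup: it is generated by some `R ∈ Ê[=p]` whose parameter has larger
(additive) valuation than that of some `Q ∈ Ê[=p]`. Since `A.valuation` is written
multiplicatively, a larger additive valuation is a smaller value of `A.valuation`. -/
def IsCanonicalSubgroup (A : ValuationSubring F) (W : WeierstrassCurve F) (p : ℕ)
    (C : AddSubgroup W.toAffine.Point) : Prop :=
  ∃ R ∈ formalTorsion A W p, ∃ Q ∈ formalTorsion A W p,
    A.valuation (formalParam R) < A.valuation (formalParam Q) ∧ C = AddSubgroup.zmultiples R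

end Points

open scoped Classical in
/-- The elliptic curve with minimal equation `W` has a canonical subgroup at the prime `𝔭` above
`p`. The points are taken over an algebraic closure of `K`, and `A` is the valuation ring of an
extension of the `𝔭`-adic valuation to this closure. All such extensions are conjugate over `K` and the conjugations
permute the points of order `p`, so the choice of the extension is immaterial. -/
def HasCanonicalSubgroup (W : WeierstrassCurve K) (𝔭 : HeightOneSpectrum (𝓞 K)) (p : ℕ) : Prop :=
  ∃ A : ValuationSubring (AlgebraicClosure K),
    A.comap (algebraMap K (AlgebraicClosure K)) = localRing 𝔭 ∧
    ∃ C, IsCanonicalSubgroup A (W.baseChange (AlgebraicClosure K)) p C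

/-- The additive valuation at the prime `𝔭` above `p`, normalized so that `v(p) = 1`, with
`v(0) = ∞`. -/
def normalizedVal (𝔭 : HeightOneSpectrum (𝓞 K)) (p : ℕ) (x : K) : WithTop ℚ :=
  open scoped Classical in
  if x = 0 then ⊤
  else ((((WithZero.log (𝔭.valuation K x) : ℤ) : ℚ) /
    ((WithZero.log (𝔭.valuation K (p : K)) : ℤ) : ℚ) : ℚ) : WithTop ℚ)

/-- The invariant `μ`. For odd `p` it is the valuation of the coefficient of `x ^ ((p² - p) / 2)` in
the `p`-th division polynomial of the minimal equation `W` (`preΨ' p` is this polynomial when `p` is odd).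
For `p = 2` it is `v(a₁² + 4a₂) / 2`. -/
def mu (W : WeierstrassCurve K) (𝔭 : HeightOneSpectrum (𝓞 K)) (p : ℕ) : WithTop ℚ :=
  if p = 2 then
    (normalizedVal 𝔭 p (W.a₁ ^ 2 + 4 * W.a₂)).map (· / 2)
  else normalizedVal 𝔭 p ((W.preΨ' p).coeff ((p ^ 2 - p) / 2))

end SupersingularTorsion

end

/-! Write `v` multiplicatively and extend it to an algebraic closure. Supersingularity says that
`ΨSq p` has no root on the reduced curve, so modulo `𝔭` it is a nonzero constant. Its roots, with
multiplicity, are the x-coordinates of the nonzero `p`-torsion points, and its leading coefficient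
is `p ^ 2`. Hence all these points have `v(x) > 1` and `v(p)^2 ∏ v(x(S)) = 1`
(`prod_valuation_xCoord`). On the kernel of reduction `v(Q̂)^2 v(x(Q)) = 1`
(`valuation_formalParam`), so a large `v(x)` means a point close to the origin, and every bound on
`v(x)` is a bound on the formal parameter.

Passing from order `p ^ n` to order `p ^ (n + 1)` uses `x(pT) ΨSq_p(x(T)) = Φ_p(x(T))` with `Φ_p`
monic of degree `p ^ 2` and integral, so that `v(x(pT)) v(ΨSq_p(x(T))) = v(x(T))^(p^2)`. Three
consequences carry the ramification statements. If all points of order `p` are equally close to the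
origin, then `v(p) = v(T̂)^N` with `N = p^(2n) - p^(2n-2)` for every `T` of order `p ^ n`
(`valuation_pow_of_forall_eq`). In every case some `T` of order `p ^ n` has `v(p) ≤ v(T̂)^N`,
strictly if the distances differ (`exists_far_point`). Finally every `T` of order `p ^ n` has `v(p)
< v(T̂)^φ(p^n)` (`valuation_pow_lt`). As `T̂` lies in the field under consideration, where the
valuation is discrete, these become a divisibility or a lower bound for the ramification index.

The criterion for a canonical subgroup is a Newton polygon argument. For each `c > 1` the
`p`-torsion points with `v(x) ≥ c` form, with the origin, a subgroup of a group of order `p ^ 2`. So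
if the distances differ, exactly `p - 1` points are closest, and the polygon has a vertex at the
coefficient that defines `μ` (`exists_ne_iff_of_roots`).

No formal group is used. The subgroups come from a direct estimate for three collinear points
(`le_valuation_third_root`). The multiplication formula `isXRep_nsmul` and the count of torsion
points `ncard_torsion` are proved from the addition law; the formula is also needed in
characteristic `p`, for the reduced curve, and is therefore obtained from a generic identity over
the universal Weierstrass curve. -/

noncomputable section

namespace WeierstrassCurve.Affine.Point

open Polynomial

/-! ### Addition and duplication formulas for x-coordinates. -/

section XCoord

variable {F : Type*} [Field F] {W : WeierstrassCurve F}

/-- The `x`-coordinate of a point, where the point at infinity has the junk value `0`. -/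
def xCoord : W.toAffine.Point → F
  | .zero => 0
  | .some x _ _ => x

@[simp] lemma xCoord_some {x y : F} (h : W.toAffine.Nonsingular x y) :
    xCoord (.some x y h) = x := rfl

@[simp] lemma xCoord_neg (P : W.toAffine.Point) : xCoord (-P) = xCoord P := by
  cases P <;> rfl

lemma exists_eq_some {P : W.toAffine.Point} (hP : P ≠ 0) :
    ∃ y, ∃ h : W.toAffine.Nonsingular (xCoord P) y, P = .some _ y h := by
  cases P with
  | zero => exact absurd rfl hP
  | some x y h => exact ⟨y, h, rfl⟩

lemma eq_or_eq_neg_of_xCoord_eq {P Q : W.toAffine.Point} (hP : P ≠ 0) (hQ : Q ≠ 0)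
    (h : xCoord P = xCoord Q) : P = Q ∨ P = -Q := by
  obtain ⟨y, hy, e⟩ := exists_eq_some hP
  obtain ⟨y', hy', e'⟩ := exists_eq_some hQ
  rw [e, e']
  exact X_eq_iff.mp h

lemma Ψ₂Sq_eval {x y : F} (h : W.toAffine.Equation x y) :
    W.Ψ₂Sq.eval x = (2 * y + W.a₁ * x + W.a₃) ^ 2 := by
  have E := (equation_iff _ _).mp h
  simp only [Ψ₂Sq, b₂, b₄, b₆]
  simp
  linear_combination -4 * E

variable [DecidableEq F]

lemma xCoord_ne_of_add_sub_ne_zero {P Q : W.toAffine.Point} (hP : P ≠ 0) (hQ : Q ≠ 0)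
    (h₁ : P + Q ≠ 0) (h₂ : P - Q ≠ 0) : xCoord P ≠ xCoord Q := by
  intro h
  rcases eq_or_eq_neg_of_xCoord_eq hP hQ h with h | h
  · exact h₂ (by rw [h, sub_self])
  · exact h₁ (by rw [h, neg_add_cancel])

/-- The sum and the product of `x(P + Q)` and `x(P - Q)`. -/
lemma xCoord_add_sub {P Q : W.toAffine.Point} (hP : P ≠ 0) (hQ : Q ≠ 0)
    (h : xCoord P ≠ xCoord Q) : P + Q ≠ 0 ∧ P - Q ≠ 0 ∧
      (xCoord (P + Q) + xCoord (P - Q)) * (xCoord P - xCoord Q) ^ 2 =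
        2 * (xCoord P + xCoord Q) * (xCoord P * xCoord Q) + W.b₂ * (xCoord P * xCoord Q) +
          W.b₄ * (xCoord P + xCoord Q) + W.b₆ ∧
      (xCoord (P + Q) * xCoord (P - Q)) * (xCoord P - xCoord Q) ^ 2 =
        (xCoord P * xCoord Q) ^ 2 - W.b₄ * (xCoord P * xCoord Q) -
          W.b₆ * (xCoord P + xCoord Q) - W.b₈ := by
  obtain ⟨y₁, hy₁, e₁⟩ := exists_eq_some hP
  obtain ⟨y₂, hy₂, e₂⟩ := exists_eq_some hQ
  generalize xCoord P = x₁ at *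
  generalize xCoord Q = x₂ at *
  subst e₁ e₂
  rw [sub_eq_add_neg, neg_some, add_of_X_ne h, add_of_X_ne h]
  refine ⟨some_ne_zero _, some_ne_zero _, ?_⟩
  simp only [xCoord_some, addX, slope_of_X_ne h, negY, b₂, b₄, b₆, b₈]
  have h' : x₁ - x₂ ≠ 0 := sub_ne_zero.mpr h
  have E₁ := (equation_iff _ _).mp hy₁.1
  have E₂ := (equation_iff _ _).mp hy₂.1
  constructor
  · field_simp
    linear_combination 2 * E₁ + 2 * E₂
  -- Here `n` and `m` stand for the numerators of the slopes of the lines through `P, Q` and through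
  -- `P, -Q`; the product is cleared of its denominator `(x₁ - x₂) ^ 4`.
  · have key : ∀ n m : F, ((n / (x₁ - x₂)) ^ 2 + W.a₁ * (n / (x₁ - x₂)) - W.a₂ - x₁ - x₂) *
        ((m / (x₁ - x₂)) ^ 2 + W.a₁ * (m / (x₁ - x₂)) - W.a₂ - x₁ - x₂) * (x₁ - x₂) ^ 2 *
        (x₁ - x₂) ^ 2 = (n ^ 2 + W.a₁ * n * (x₁ - x₂) - (W.a₂ + x₁ + x₂) * (x₁ - x₂) ^ 2) *
        (m ^ 2 + W.a₁ * m * (x₁ - x₂) - (W.a₂ + x₁ + x₂) * (x₁ - x₂) ^ 2) := by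
      intro n m
      field_simp
      ring
    apply mul_right_cancel₀ (pow_ne_zero 2 h')
    rw [key]
    have e₁ : (y₁ - y₂) ^ 2 + W.a₁ * (y₁ - y₂) * (x₁ - x₂) =
        (x₁ ^ 3 + W.a₂ * x₁ ^ 2 + W.a₄ * x₁ + W.a₆) + (x₂ ^ 3 + W.a₂ * x₂ ^ 2 + W.a₄ * x₂ + W.a₆)
          - W.a₃ * y₁ - W.a₁ * x₂ * y₁ - y₂ * (2 * y₁ + W.a₁ * x₁ + W.a₃) := by
      linear_combination E₁ + E₂
    have e₂ : (y₁ - (-y₂ - W.a₁ * x₂ - W.a₃)) ^ 2 +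
        W.a₁ * (y₁ - (-y₂ - W.a₁ * x₂ - W.a₃)) * (x₁ - x₂) =
        (x₁ ^ 3 + W.a₂ * x₁ ^ 2 + W.a₄ * x₁ + W.a₆) + (x₂ ^ 3 + W.a₂ * x₂ ^ 2 + W.a₄ * x₂ + W.a₆)
          - W.a₃ * y₁ - W.a₁ * x₂ * y₁ +
          (y₂ + W.a₁ * x₂ + W.a₃) * (2 * y₁ + W.a₁ * x₁ + W.a₃) := by
      linear_combination E₁ + E₂
    rw [e₁, e₂]
    have E₁' : y₁ ^ 2 = (x₁ ^ 3 + W.a₂ * x₁ ^ 2 + W.a₄ * x₁ + W.a₆) - W.a₁ * x₁ * y₁ - W.a₃ * y₁ := by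
      linear_combination E₁
    have E₂' : y₂ ^ 2 = (x₂ ^ 3 + W.a₂ * x₂ ^ 2 + W.a₄ * x₂ + W.a₆) - W.a₁ * x₂ * y₂ - W.a₃ * y₂ := by
      linear_combination E₂
    clear e₁ e₂ key E₁ E₂ hP hQ hy₁ hy₂
    grind

lemma add_self_eq_zero_iff {P : W.toAffine.Point} (hP : P ≠ 0) :
    P + P = 0 ↔ W.Ψ₂Sq.eval (xCoord P) = 0 := by
  obtain ⟨y, hy, e⟩ := exists_eq_some hP
  generalize xCoord P = x at *
  subst e
  rw [Ψ₂Sq_eval hy.1, sq_eq_zero_iff]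
  constructor
  · intro h
    by_contra h'
    rw [add_self_of_Y_ne (fun h'' => h' (by rw [negY] at h''; linear_combination h''))] at h
    exact some_ne_zero _ h
  · intro h
    exact add_self_of_Y_eq (by rw [negY]; linear_combination h)

lemma xCoord_add_self {P : W.toAffine.Point} (hP : P ≠ 0) (h : P + P ≠ 0) :
    xCoord (P + P) * W.Ψ₂Sq.eval (xCoord P) = (W.Φ 2).eval (xCoord P) := by
  have h₂ := (add_self_eq_zero_iff hP).not.mp h
  obtain ⟨y, hy, e⟩ := exists_eq_some hP
  generalize xCoord P = x at *
  subst e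
  rw [Ψ₂Sq_eval hy.1] at h₂ ⊢
  have h₃ : 2 * y + W.a₁ * x + W.a₃ ≠ 0 := fun h => h₂ (by rw [h]; ring)
  have hY : y ≠ W.toAffine.negY x y := fun h'' => h₃ (by rw [negY] at h''; linear_combination h'')
  have E := (equation_iff _ _).mp hy.1
  rw [add_self_of_Y_ne hY, xCoord_some, addX, slope_of_Y_ne rfl hY]
  have e : y - W.toAffine.negY x y = 2 * y + W.a₁ * x + W.a₃ := by rw [negY]; ring
  rw [e]
  have key : ∀ D N : F, D ≠ 0 → ((N / D) ^ 2 + W.a₁ * (N / D) - W.a₂ - x - x) * D ^ 2 =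
      N ^ 2 + W.a₁ * N * D - (W.a₂ + x + x) * D ^ 2 := by
    intro D N hD
    field_simp
    ring
  rw [key _ _ h₃]
  have a₆ : W.a₆ = y ^ 2 + W.a₁ * x * y + W.a₃ * y - (x ^ 3 + W.a₂ * x ^ 2 + W.a₄ * x) := by
    linear_combination -E
  simp only [Φ_two, b₄, b₆, b₈]
  simp only [eval_sub, eval_mul, eval_pow, eval_C, eval_X]
  rw [a₆]
  ring

end XCoord

end WeierstrassCurve.Affine.Point

namespace WeierstrassCurve.Affine.Point

open Polynomial

/-! ### Elliptic sequences from the biquadratic relation between x-coordinates. -/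

section EDS

variable {F : Type*} [Field F]

/-- The biquadratic form in `X` vanishing at `x(P + Q)` and `x(P - Q)`, as a symmetric expression
in `X`, `x(P)` and `x(Q)`. -/
def biquad (W : WeierstrassCurve F) (X x₁ x₂ : F) : F :=
  X ^ 2 * (x₁ - x₂) ^ 2 - X * (2 * (x₁ + x₂) * (x₁ * x₂) + W.b₂ * (x₁ * x₂) +
    W.b₄ * (x₁ + x₂) + W.b₆) + ((x₁ * x₂) ^ 2 - W.b₄ * (x₁ * x₂) - W.b₆ * (x₁ + x₂) - W.b₈)

lemma biquad_rotate (W : WeierstrassCurve F) (X x₁ x₂ : F) :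
    biquad W X x₁ x₂ = biquad W x₁ X x₂ := by
  simp only [biquad]
  ring

/-- A sequence `w` with `w (j + 1) w (j - 1) = (x 1 - x j) w j ^ 2` is elliptic, where `x j` are the
`x`-coordinates of the multiples of a point. -/
lemma elliptic_of_biquad (W : WeierstrassCurve F) {x w : ℕ → F} {k : ℕ} (hw₁ : w 1 = 1)
    (hw : ∀ j, 1 ≤ j → j ≤ k → w j ≠ 0)
    (h : ∀ j < k, w (j + 2) * w j = (x 1 - x (j + 1)) * w (j + 1) ^ 2)
    (hadd : ∀ j, 1 ≤ j → j + 2 ≤ k → ∀ X,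
      (x (j + 2) - X) * (x j - X) * (x (j + 1) - x 1) ^ 2 = biquad W X (x (j + 1)) (x 1))
    (hdbl : 2 ≤ k → ∀ X, (x 2 - X) * w 2 ^ 2 = biquad W X (x 1) (x 1))
    (hne : ∀ i j, 1 ≤ i → i < j → i + j ≤ k → x i ≠ x j) (n : ℕ) :
    ∀ d, 1 ≤ n → 1 ≤ d → 2 * n + d ≤ k + 1 →
      w (2 * n + d) * w d = (x n - x (n + d)) * w (n + d) ^ 2 * w n ^ 2 := by
  induction n using Nat.strong_induction_on with
  | _ n ih =>
  intro d hn hd hk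
  match n, hn with
  | 1, _ =>
    have := h d (by omega)
    rw [show 2 * 1 + d = d + 2 by ring, show 1 + d = d + 1 by ring, this, hw₁]
    ring
  -- The duplication formula `hdbl` replaces the relation `hadd`, which here would involve the point
  -- at infinity as the zeroth multiple.
  | 2, _ =>
    have h₁ := h (d + 2) (by omega)
    have h₂ := h d (by omega)
    have h₃ := h (d + 1) (by omega)
    have h₄ := hdbl (by omega) (x (d + 2))
    have h₅ := hadd (d + 1) (by omega) (by omega) (x 1)
    rw [biquad_rotate] at h₅
    have hne := hw (d + 2) (by omega) (by omega)
    rw [show 2 * 2 + d = d + 2 + 2 by ring, show 2 + d = d + 2 by ring]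
    simp only [show d + 2 + 1 = d + 1 + 2 by ring, show d + 1 + 1 = d + 2 by ring] at *
    apply mul_right_cancel₀ (pow_ne_zero 2 hne)
    linear_combination w (d + 2) * w d * h₁ + (x 1 - x (d + 3)) * w (d + 3) ^ 2 * h₂ +
      (x 1 - x (d + 3)) * (x 1 - x (d + 1)) * (w (d + 3) * w (d + 1) +
        (x 1 - x (d + 2)) * w (d + 2) ^ 2) * h₃ + w (d + 2) ^ 4 * h₅ - w (d + 2) ^ 4 * h₄
  -- The goal is `h₁` times `h₂` divided by `h₃`, whose right side is the cancelled factor. What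
  -- remains is an identity between differences of x-coordinates: by the symmetry of `biquad`, `h₄`
  -- and `h₅` have the same right side. `h₆` and `h₇` exchange the squared differences from `x 1`
  -- for values of `w`.
  | n + 3, _ => 
    have h₁ := ih (n + 2) (by omega) (d + 2) (by omega) (by omega) (by omega)
    have h₂ := ih (n + 2) (by omega) d (by omega) (by omega) (by omega)
    have h₃ := ih (n + 1) (by omega) (d + 2) (by omega) (by omega) (by omega)
    have h₄ := hadd (n + 1) (by omega) (by omega) (x (n + 3 + d))
    have h₅ := hadd (n + 2 + d) (by omega) (by omega) (x (n + 2))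
    have h₆ := h (n + 2 + d) (by omega)
    have h₇ := h (n + 1) (by omega)
    have n₁ := hw (n + 3 + d) (by omega) (by omega)
    have n₂ := hw (n + 1) (by omega) (by omega)
    have n₃ := sub_ne_zero.mpr (hne (n + 1) (n + 3 + d) (by omega) (by omega) (by omega))
    rw [show 2 * (n + 2) + (d + 2) = 2 * (n + 3) + d by ring] at h₁
    rw [show 2 * (n + 1) + (d + 2) = 2 * (n + 2) + d by ring] at h₃
    simp only [show n + 2 + (d + 2) = n + 4 + d by ring, show n + 1 + (d + 2) = n + 3 + d by ring,
      show n + 2 + d + 2 = n + 4 + d by ring, show n + 2 + d + 1 = n + 3 + d by ring,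
      show n + 1 + 2 = n + 3 by ring, show n + 1 + 1 = n + 2 by ring] at *
    rw [biquad_rotate] at h₅
    apply mul_right_cancel₀ (mul_ne_zero n₃ (mul_ne_zero (pow_ne_zero 2 n₁) (pow_ne_zero 2 n₂)))
    linear_combination -w (2 * (n + 3) + d) * w d * h₃ + w d * w (2 * (n + 2) + d) * h₁ +
      (x (n + 2) - x (n + 4 + d)) * w (n + 4 + d) ^ 2 * w (n + 2) ^ 2 * h₂ +
      (x (n + 2) - x (n + 4 + d)) * (x (n + 2) - x (n + 2 + d)) * w (n + 2) ^ 4 *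
        (w (n + 4 + d) * w (n + 2 + d) + (x 1 - x (n + 3 + d)) * w (n + 3 + d) ^ 2) * h₆ +
      w (n + 3 + d) ^ 4 * w (n + 2) ^ 4 * h₅ - w (n + 3 + d) ^ 4 * w (n + 2) ^ 4 * h₄ -
      (x (n + 3) - x (n + 3 + d)) * (x (n + 1) - x (n + 3 + d)) * w (n + 3 + d) ^ 4 *
        (w (n + 3) * w (n + 1) + (x 1 - x (n + 2)) * w (n + 2) ^ 2) * h₇

end EDS

/-! ### The multiplication formula at points where no division polynomial vanishes. -/

section Generic

variable {F : Type*} [Field F] (W : WeierstrassCurve F)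

/-- The value of the `n`-th bivariate division polynomial at `(x, y)`. -/
def ψVal (x y : F) (n : ℕ) : F :=
  normEDS (2 * y + W.a₁ * x + W.a₃) (W.Ψ₃.eval x) (W.preΨ₄.eval x) n

variable {W}

lemma ψVal_eq {x y : F} (h : W.toAffine.Equation x y) (n : ℕ) :
    ψVal W x y n = (W.preΨ' n).eval x * if Even n then 2 * y + W.a₁ * x + W.a₃ else 1 := by
  have h₂ : (2 * y + W.a₁ * x + W.a₃) ^ 4 = (evalRingHom x) (W.Ψ₂Sq ^ 2) := by
    rw [coe_evalRingHom, eval_pow, Ψ₂Sq_eval h]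
    ring
  rw [ψVal, normEDS_ofNat, h₂, preΨ', ← coe_evalRingHom, map_preNormEDS']

lemma ψVal_sq {x y : F} (h : W.toAffine.Equation x y) (n : ℕ) :
    ψVal W x y n ^ 2 = (W.ΨSq n).eval x := by
  rw [ψVal_eq h, ΨSq_ofNat]
  split_ifs <;> simp [mul_pow, Ψ₂Sq_eval h]

lemma ψVal_Φ {x y : F} (h : W.toAffine.Equation x y) (n : ℕ) :
    (W.Φ (n + 1)).eval x = x * ψVal W x y (n + 1) ^ 2 - ψVal W x y (n + 2) * ψVal W x y n := by
  rw [ψVal_sq h, ψVal_eq h, ψVal_eq h, Φ_ofNat, ΨSq_ofNat]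
  simp only [Nat.even_add_one, not_not, show n + 2 = n + 1 + 1 from rfl]
  split_ifs <;> simp [Ψ₂Sq_eval h] <;> ring

lemma ψVal_odd (x y : F) (i : ℕ) : ψVal W x y (2 * i + 3) =
    ψVal W x y (i + 3) * ψVal W x y (i + 1) ^ 3 - ψVal W x y i * ψVal W x y (i + 2) ^ 3 := by
  have := normEDS_odd (2 * y + W.a₁ * x + W.a₃) (W.Ψ₃.eval x) (W.preΨ₄.eval x) (i + 1)
  simp only [ψVal]
  push_cast
  rw [show (2 * (i : ℤ) + 3) = 2 * (i + 1) + 1 by ring, this]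
  ring_nf

lemma ψVal_even (x y : F) (i : ℕ) : ψVal W x y (2 * i + 4) * ψVal W x y 2 =
    ψVal W x y (i + 1) ^ 2 * ψVal W x y (i + 2) * ψVal W x y (i + 4) -
      ψVal W x y i * ψVal W x y (i + 2) * ψVal W x y (i + 3) ^ 2 := by
  have := normEDS_even (2 * y + W.a₁ * x + W.a₃) (W.Ψ₃.eval x) (W.preΨ₄.eval x) (i + 2)
  simp only [ψVal]
  push_cast
  rw [show (2 * (i : ℤ) + 4) = 2 * (i + 2) by ring, normEDS_two, this]
  ring_nf

variable [DecidableEq F]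

/-- This is the case of `3P` in `ψVal_generic`, which the recursion there cannot reach. It follows
from the formula for `x(2P + P) + x(2P - P)`, rewritten by an explicit polynomial identity for
`preΨ₄`. -/
lemma xCoord_three {x y : F} (h : W.toAffine.Nonsingular x y)
    (h₃ : ψVal W x y 3 ≠ 0)
    (hd : (2 : ℕ) • Point.some x y h ≠ 0)
    (hx₂ : (x - xCoord ((2 : ℕ) • Point.some x y h)) * ψVal W x y 2 ^ 2 = ψVal W x y 3) :
    (x - xCoord ((3 : ℕ) • Point.some x y h)) * ψVal W x y 3 ^ 2 =
      ψVal W x y 4 * ψVal W x y 2 := by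
  have hne : xCoord ((2 : ℕ) • Point.some x y h) ≠ x := by
    intro e
    rw [e, sub_self, zero_mul] at hx₂
    exact h₃ hx₂.symm
  have := (xCoord_add_sub hd (some_ne_zero h) hne).2.2.1
  rw [show (2 : ℕ) • Point.some x y h - Point.some x y h = Point.some x y h by
    rw [two_nsmul, add_sub_cancel_right], ← succ_nsmul, xCoord_some] at this
  norm_num at this
  generalize xCoord (2 • Point.some x y h) = x₂ at *
  generalize xCoord (3 • Point.some x y h) = x₃ at *
  have e₃ : ψVal W x y 3 = W.Ψ₃.eval x := by simp [ψVal]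
  have e₄ : ψVal W x y 4 = W.preΨ₄.eval x * ψVal W x y 2 := by simp [ψVal]
  have e₂ : ψVal W x y 2 ^ 2 = W.Ψ₂Sq.eval x := by rw [ψVal_sq h.1]; simp
  rw [e₄, mul_assoc, ← sq]
  have key : W.preΨ₄.eval x * W.Ψ₂Sq.eval x = 2 * x * W.Ψ₃.eval x ^ 2 -
      (2 * x * (W.Φ 2).eval x * (x * W.Ψ₂Sq.eval x + (W.Φ 2).eval x) +
        W.b₂ * x * (W.Φ 2).eval x * W.Ψ₂Sq.eval x + W.b₄ * W.Ψ₂Sq.eval x *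
          (x * W.Ψ₂Sq.eval x + (W.Φ 2).eval x) + W.b₆ * W.Ψ₂Sq.eval x ^ 2) := by
    have hb := W.b_relation
    simp only [Φ_two, Ψ₃, preΨ₄, Ψ₂Sq]
    simp
    generalize W.b₂ = b₂ at *
    generalize W.b₄ = b₄ at *
    generalize W.b₆ = b₆ at *
    generalize W.b₈ = b₈ at *
    clear this hx₂ e₂ e₃ e₄ hne hd h₃ h
    grind
  have eΦ : (W.Φ 2).eval x = x₂ * W.Ψ₂Sq.eval x := by
    have : (W.Φ 2).eval x = x * W.Ψ₂Sq.eval x - W.Ψ₃.eval x := by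
      simp only [Φ_two, Ψ₃, Ψ₂Sq]
      simp
      ring
    rw [this, ← e₃, ← hx₂, e₂]
    ring
  rw [e₂, key, eΦ, e₃]
  rw [e₂, e₃] at hx₂
  rw [← hx₂]
  linear_combination -(W.Ψ₂Sq.eval x) ^ 2 * this

/-- The relation says that the next division polynomial is the value forced by the x-coordinates of
multiples of `P`. The values forced in this way form an elliptic sequence by `elliptic_of_biquad`,
and an elliptic sequence satisfies the doubling recursions that define `ψ`. The hypothesis `hN`
permits all the divisions and keeps the multiples in question nonzero with distinct x-coordinates.
-/
theorem ψVal_generic {x y : F} (h : W.toAffine.Nonsingular x y) {N : ℕ}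
    (hN : ∀ j, 1 ≤ j → j ≤ N → ψVal W x y j ≠ 0) (k : ℕ) : k + 2 ≤ N →
    (k + 1) • Point.some x y h ≠ 0 ∧
      (x - xCoord ((k + 1) • Point.some x y h)) * ψVal W x y (k + 1) ^ 2 =
        ψVal W x y (k + 2) * ψVal W x y k := by
  induction k using Nat.strong_induction_on with
  | _ k ih =>
  intro hk
  have hP := some_ne_zero h
  have hs0 : ψVal W x y 0 = 0 := by simp [ψVal]
  have hs1 : ψVal W x y 1 = 1 := by simp [ψVal]
  rcases Nat.eq_zero_or_pos k with rfl | hk0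
  · simp [hs0, hP]
  have hne : (k + 1) • Point.some x y h ≠ 0 := by
    obtain ⟨i, rfl⟩ : ∃ i, k = i + 1 := ⟨k - 1, by omega⟩
    obtain ⟨h₁, h₂⟩ := ih i (by omega) (by omega)
    intro h₀
    rcases Nat.eq_zero_or_pos i with rfl | hi
    · rw [zero_add, two_nsmul, add_self_eq_zero_iff hP, xCoord_some, Ψ₂Sq_eval h.1] at h₀
      apply hN 2 (by omega) (by omega)
      simp only [ψVal, Nat.cast_ofNat, normEDS_two]
      exact pow_eq_zero_iff (two_ne_zero) |>.mp h₀
    -- If `(i + 2)P = 0`, then `(i + 1)P = -P` has the same x-coordinate as `P`, which forces a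
    -- product of nonzero values of `ψ` to vanish.
    · have h₃ : (i + 1) • Point.some x y h = -Point.some x y h := by
        rw [succ_nsmul] at h₀
        exact eq_neg_of_add_eq_zero_left h₀
      rw [h₃, xCoord_neg, xCoord_some, sub_self, zero_mul] at h₂
      exact mul_ne_zero (hN (i + 2) (by omega) (by omega)) (hN i (by omega) (by omega)) h₂.symm
  refine ⟨hne, ?_⟩
  rcases (show k = 1 ∨ k = 2 ∨ 3 ≤ k by omega) with rfl | rfl | hk3
  · have h₁ := xCoord_add_self hP (by rwa [← two_nsmul])
    rw [xCoord_some, ← two_nsmul] at h₁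
    have h₂ : (W.Φ 2).eval x = _ := ψVal_Φ h.1 1
    rw [ψVal_sq h.1 2] at *
    simp only [Nat.reduceAdd] at *
    rw [Nat.cast_ofNat, ΨSq_two] at *
    linear_combination -h₁ - h₂
  · obtain ⟨h₁, h₂⟩ := ih 1 (by omega) (by omega)
    simp only [Nat.reduceAdd, hs1, mul_one] at h₂
    exact xCoord_three h (hN 3 (by omega) (by omega)) h₁ h₂
  have nz : ∀ j, 1 ≤ j → j ≤ k + 1 → j • Point.some x y h ≠ 0 := by
    intro j hj hj'
    rcases hj'.eq_or_lt with rfl | hj'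
    · exact hne
    · obtain ⟨i, rfl⟩ : ∃ i, j = i + 1 := ⟨j - 1, by omega⟩
      exact (ih i (by omega) (by omega)).1
  have xne : ∀ i j, 1 ≤ i → i < j → i + j ≤ k + 1 →
      xCoord (i • Point.some x y h) ≠ xCoord (j • Point.some x y h) := by
    intro i j hi hij hijk
    refine (xCoord_ne_of_add_sub_ne_zero (nz j (by omega) (by omega)) (nz i hi (by omega))
      ?_ ?_).symm
    · rw [← add_nsmul]
      exact nz _ (by omega) (by omega)
    · obtain ⟨d, rfl⟩ := Nat.exists_eq_add_of_lt hij
      rw [add_assoc, add_nsmul, add_sub_cancel_left]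
      exact nz _ (by omega) (by omega)
  set xs : ℕ → F := fun j => xCoord (j • Point.some x y h) with hxs
  -- The sequence is `ψ` as far as the induction hypothesis reaches, and its last term is defined so
  -- that the desired relation holds. It then remains to prove that this last term is `ψ (k + 2)`.
  set w : ℕ → F := fun j => if j ≤ k + 1 then ψVal W x y j else
    (x - xs (k + 1)) * ψVal W x y (k + 1) ^ 2 / ψVal W x y k with hw
  have wle : ∀ j ≤ k + 1, w j = ψVal W x y j := fun j hj => by simp [hw, hj]
  have hx1 : xs 1 = x := by simp [hxs]
  have hψk := hN k hk0 (by omega)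
  have wlast : w (k + 2) * ψVal W x y k = (x - xs (k + 1)) * ψVal W x y (k + 1) ^ 2 := by
    simp [hw, hψk]
  have ih' : ∀ j < k, (x - xs (j + 1)) * ψVal W x y (j + 1) ^ 2 =
      ψVal W x y (j + 2) * ψVal W x y j := fun j hj => (ih j hj (by omega)).2
  have E := elliptic_of_biquad W (x := xs) (w := w) (k := k + 1) (by rw [wle 1 (by omega), hs1])
    (fun j hj hj' => by rw [wle j hj']; exact hN j hj (by omega))
    (fun j hj => by
      rcases (show j < k ∨ j = k by omega) with hj | rfl
      · rw [wle _ (by omega), wle _ (by omega), wle _ (by omega), hx1, ih' j hj]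
      · rw [wle j (by omega), wle (j + 1) le_rfl, wlast, hx1])
    (fun j hj hj' X => by
      have hne := (xne 1 (j + 1) le_rfl (by omega) (by omega)).symm
      obtain ⟨-, -, h₁, h₂⟩ := xCoord_add_sub (nz (j + 1) (by omega) (by omega))
        (nz 1 le_rfl (by omega)) hne
      have hs : (j + 1) • Point.some x y h - Point.some x y h = j • Point.some x y h := by
        rw [succ_nsmul, add_sub_cancel_right]
      rw [one_nsmul, ← succ_nsmul, hs] at h₁ h₂
      simp only [biquad, hxs, one_nsmul]
      linear_combination (-X) * h₁ + h₂)
    (fun _ X => by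
      have h₁ := xCoord_add_self hP (by rw [← two_nsmul]; exact nz 2 (by omega) (by omega))
      rw [← two_nsmul, xCoord_some] at h₁
      rw [wle 2 (by omega), ψVal_sq h.1, Nat.cast_ofNat, ΨSq_two, hx1, sub_mul]
      simp only [hxs]
      rw [h₁]
      simp only [Φ_two, Ψ₂Sq, biquad]
      simp
      ring) xne
  have hfin : w (k + 2) = ψVal W x y (k + 2) := by
    -- The elliptic relation with difference `1` or `2`, according to parity, gives `w (k + 2)` in
    -- terms of lower values exactly as the recursions `ψVal_odd` and `ψVal_even` do. Since `k ≥ 3`,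
    -- the lower values are covered by `ih'`.
    obtain ⟨m, hm | hm⟩ : ∃ m, k + 2 = 2 * m + 3 ∨ k + 2 = 2 * m + 4 :=
      ⟨(k - 1) / 2, by omega⟩
    · have h₁ := E (m + 1) 1 (by omega) (by omega) (by omega)
      rw [show 2 * (m + 1) + 1 = k + 2 by omega, wle 1 (by omega), hs1, mul_one,
        wle (m + 1) (by omega), wle (m + 1 + 1) (by omega)] at h₁
      rw [h₁, hm, ψVal_odd]
      have a := ih' m (by omega)
      have b := ih' (m + 1) (by omega)
      simp only [add_assoc, Nat.reduceAdd] at a b ⊢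
      linear_combination ψVal W x y (m + 1) ^ 2 * b - ψVal W x y (m + 2) ^ 2 * a
    · have h₁ := E (m + 1) 2 (by omega) (by omega) (by omega)
      rw [show 2 * (m + 1) + 2 = k + 2 by omega, wle 2 (by omega),
        wle (m + 1) (by omega), wle (m + 1 + 2) (by omega)] at h₁
      apply mul_right_cancel₀ (hN 2 (by omega) (by omega))
      rw [h₁, hm, ψVal_even]
      have a := ih' m (by omega)
      have b := ih' (m + 2) (by omega)
      simp only [add_assoc, Nat.reduceAdd] at a b ⊢
      linear_combination ψVal W x y (m + 1) ^ 2 * b - ψVal W x y (m + 3) ^ 2 * a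
  rw [← hfin, wlast]

end Generic

end WeierstrassCurve.Affine.Point

namespace WeierstrassCurve

open Polynomial Affine.Point

/-! ### The generic identities as polynomial identities over every ring. -/

section Universal

variable {R S : Type*} [CommRing R] [CommRing S] (W : WeierstrassCurve R)

/-- The defect in the relation `x((n + 2)P) x(nP) = …` between division polynomials. -/
def mulDefect (n : ℕ) : R[X] :=
  W.Φ (n + 2 : ℕ) * W.Φ n - ((X * W.Φ (n + 1 : ℕ)) ^ 2 - C W.b₄ * (X * W.Φ (n + 1 : ℕ)) * W.ΨSq (n + 1 : ℕ) -
    C W.b₆ * (W.Φ (n + 1 : ℕ) + X * W.ΨSq (n + 1 : ℕ)) * W.ΨSq (n + 1 : ℕ) - C W.b₈ * W.ΨSq (n + 1 : ℕ) ^ 2)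

/-- The defect in the relation `x((n + 2)P) + x(nP) = …` between division polynomials. -/
def addDefect (n : ℕ) : R[X] :=
  W.Φ (n + 2 : ℕ) * W.ΨSq n + W.Φ n * W.ΨSq (n + 2 : ℕ) -
    (2 * (W.Φ (n + 1 : ℕ) + X * W.ΨSq (n + 1 : ℕ)) * (X * W.Φ (n + 1 : ℕ)) +
      C W.b₂ * (X * W.Φ (n + 1 : ℕ)) * W.ΨSq (n + 1 : ℕ) +
      C W.b₄ * (W.Φ (n + 1 : ℕ) + X * W.ΨSq (n + 1 : ℕ)) * W.ΨSq (n + 1 : ℕ) + C W.b₆ * W.ΨSq (n + 1 : ℕ) ^ 2)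

lemma map_mulDefect (f : R →+* S) (n : ℕ) : (W.map f).mulDefect n = (W.mulDefect n).map f := by
  simp only [mulDefect, map_Φ, map_ΨSq, map_b₄, map_b₆, map_b₈, Polynomial.map_sub,
    Polynomial.map_mul, Polynomial.map_add, Polynomial.map_pow, map_X, map_C]

lemma map_addDefect (f : R →+* S) (n : ℕ) : (W.map f).addDefect n = (W.addDefect n).map f := by
  simp only [addDefect, map_Φ, map_ΨSq, map_b₂, map_b₄, map_b₆, Polynomial.map_sub,
    Polynomial.map_mul, Polynomial.map_add, Polynomial.map_pow, map_X, map_C, Polynomial.map_ofNat]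

lemma exists_equation {F : Type*} [Field F] [IsAlgClosed F] (W : WeierstrassCurve F) (x : F) :
    ∃ y, W.toAffine.Equation x y := by
  obtain ⟨y, hy⟩ := IsAlgClosed.exists_root
    (X ^ 2 + C (W.a₁ * x + W.a₃) * X - C (x ^ 3 + W.a₂ * x ^ 2 + W.a₄ * x + W.a₆) : F[X])
    (by
      rw [show (X ^ 2 + C (W.a₁ * x + W.a₃) * X -
        C (x ^ 3 + W.a₂ * x ^ 2 + W.a₄ * x + W.a₆) : F[X]) = C 1 * X ^ 2 + C (W.a₁ * x + W.a₃) * X +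
        C (-(x ^ 3 + W.a₂ * x ^ 2 + W.a₄ * x + W.a₆)) by
        simp only [C_neg, C_1]; ring]
      rw [degree_quadratic one_ne_zero]
      decide)
  refine ⟨y, (Affine.equation_iff _ _).mpr ?_⟩
  simp [IsRoot.def] at hy
  linear_combination hy

section Field

variable {F : Type*} [Field F] (W : WeierstrassCurve F) [W.IsElliptic]

/-- The formulas of `xCoord_add_sub` for `(n + 1)P` and `P`, homogenised by substituting the
fractions of `ψVal_generic`. -/
lemma defect_eval_eq_zero [DecidableEq F] {x y : F} (h : W.toAffine.Equation x y) {n : ℕ}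
    (hn : n ≠ 0) (hN : ∀ j, 1 ≤ j → j ≤ n + 3 → ψVal W x y j ≠ 0) :
    (W.mulDefect n).eval x = 0 ∧ (W.addDefect n).eval x = 0 := by
  have h' := (Affine.equation_iff_nonsingular (W := W)).mp h
  obtain ⟨n, rfl⟩ := Nat.exists_eq_succ_of_ne_zero hn
  have H := ψVal_generic h' hN
  obtain ⟨n₀, e₀⟩ := H n (by omega)
  obtain ⟨n₁, e₁⟩ := H (n + 1) (by omega)
  obtain ⟨n₂, e₂⟩ := H (n + 2) (by omega)
  have f : ∀ m : ℕ, (W.Φ (m + 1 : ℕ)).eval x =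
      x * ψVal W x y (m + 1) ^ 2 - ψVal W x y (m + 2) * ψVal W x y m := fun m => by
    rw [← ψVal_Φ h m, Nat.cast_succ]
  have f₀ := f n
  have f₁ := f (n + 1)
  have f₂ := f (n + 2)
  have g₀ := ψVal_sq h (n + 1)
  have g₁ := ψVal_sq h (n + 2)
  have g₂ := ψVal_sq h (n + 3)
  rw [← e₀] at f₀
  rw [← e₁] at f₁
  rw [← e₂] at f₂
  have hne : xCoord ((n + 1 + 1) • some x y h') ≠ xCoord (some x y h') := by
    intro e
    rw [e, xCoord_some, sub_self, zero_mul] at e₁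
    exact mul_ne_zero (hN _ (by omega) (by omega)) (hN _ (by omega) (by omega)) e₁.symm
  obtain ⟨-, -, a, b⟩ := xCoord_add_sub n₁ (some_ne_zero h') hne
  rw [← succ_nsmul, succ_nsmul (some x y h') (n + 1), add_sub_cancel_right, ← succ_nsmul,
    xCoord_some] at a b
  simp only [mulDefect, addDefect]
  simp only [add_assoc, Nat.reduceAdd, Nat.succ_eq_add_one] at *
  simp only [eval_sub, eval_add, eval_mul, eval_pow, eval_X, eval_C, eval_ofNat]
  rw [f₀, f₁, f₂, ← g₀, ← g₁, ← g₂]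
  generalize xCoord ((n + 1) • some x y h') = x₀ at *
  generalize xCoord ((n + 2) • some x y h') = x₁ at *
  generalize xCoord ((n + 3) • some x y h') = x₂ at *
  generalize ψVal W x y (n + 1) = s₀ at *
  generalize ψVal W x y (n + 2) = s₁ at *
  generalize ψVal W x y (n + 3) = s₂ at *
  constructor
  · linear_combination s₁ ^ 4 * b - x₂ * x₀ * ((x - x₁) * s₁ ^ 2 + s₂ * s₀) * e₁
  · linear_combination s₁ ^ 4 * a - (x₂ + x₀) * ((x - x₁) * s₁ ^ 2 + s₂ * s₀) * e₁

lemma defect_eq_zero_of_charZero [IsAlgClosed F] [CharZero F] (n : ℕ) :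
    W.mulDefect n = 0 ∧ W.addDefect n = 0 := by
  classical
  rcases eq_or_ne n 0 with rfl | hn
  · simp only [mulDefect, addDefect]
    simp [Φ_two, Ψ₂Sq]
    have c2 : (C 2 : F[X]) = 2 := map_ofNat C 2
    have c4 : (C 4 : F[X]) = 4 := map_ofNat C 4
    rw [c2, c4]
    constructor <;> ring
  -- Outside the roots of this product all the relevant `ψ j` are nonzero at a point over `x`;
  -- `Ψ₂Sq` is included because `ψ j` for even `j` contains a square root of its value as a factor.
  have bad : (W.Ψ₂Sq * ∏ j ∈ Finset.Icc 1 (n + 3), W.preΨ' j) ≠ 0 := by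
    refine mul_ne_zero (W.Ψ₂Sq_ne_zero (by norm_num)) (Finset.prod_ne_zero_iff.mpr fun j hj => ?_)
    exact W.preΨ'_ne_zero (by simpa using (Nat.one_le_iff_ne_zero.mp (Finset.mem_Icc.mp hj).1))
  have key : ∀ x, (W.Ψ₂Sq * ∏ j ∈ Finset.Icc 1 (n + 3), W.preΨ' j).eval x ≠ 0 →
      (W.mulDefect n).eval x = 0 ∧ (W.addDefect n).eval x = 0 := by
    intro x hx
    rw [eval_mul, eval_prod] at hx
    obtain ⟨y, h⟩ := exists_equation W x
    refine defect_eval_eq_zero W h hn fun j hj hj' => ?_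
    rw [ψVal_eq h]
    have h₁ := left_ne_zero_of_mul hx
    have h₂ := Finset.prod_ne_zero_iff.mp (right_ne_zero_of_mul hx) j
      (Finset.mem_Icc.mpr ⟨hj, hj'⟩)
    rw [Ψ₂Sq_eval h] at h₁
    refine mul_ne_zero h₂ ?_
    split_ifs
    · exact fun h₀ => h₁ (by rw [h₀]; ring)
    · exact one_ne_zero
  constructor
  · refine (mul_eq_zero.mp (Polynomial.funext fun x => ?_)).resolve_right bad
    rw [eval_mul, eval_zero]
    by_contra h₀
    exact left_ne_zero_of_mul h₀ (key x (right_ne_zero_of_mul h₀)).1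
  · refine (mul_eq_zero.mp (Polynomial.funext fun x => ?_)).resolve_right bad
    rw [eval_mul, eval_zero]
    by_contra h₀
    exact left_ne_zero_of_mul h₀ (key x (right_ne_zero_of_mul h₀)).2

end Field

/-- The universal Weierstrass curve. -/
def universal : WeierstrassCurve (MvPolynomial (Fin 5) ℤ) :=
  ⟨.X 0, .X 1, .X 2, .X 3, .X 4⟩

lemma universal_map : universal.map
    (MvPolynomial.eval₂Hom (Int.castRingHom R) (![W.a₁, W.a₂, W.a₃, W.a₄, W.a₆] : Fin 5 → R)) = W := by
  ext <;> simp [universal, map]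

lemma universal_Δ_ne_zero : universal.Δ ≠ 0 := by
  intro h
  have := congrArg (MvPolynomial.eval₂Hom (Int.castRingHom ℤ) (![0, 0, 0, 0, 1] : Fin 5 → ℤ)) h
  rw [← map_Δ, universal_map (⟨0, 0, 0, 0, 1⟩ : WeierstrassCurve ℤ)] at this
  norm_num [Δ, b₂, b₄, b₆, b₈] at this

/-- Polynomial identities descend from an algebraically closed field of characteristic zero to the
universal curve, because its coefficient ring embeds there, and then specialise to any curve over
any ring. -/
theorem defect_eq_zero (n : ℕ) : W.mulDefect n = 0 ∧ W.addDefect n = 0 := by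
  let F := AlgebraicClosure (FractionRing (MvPolynomial (Fin 5) ℤ))
  let f : MvPolynomial (Fin 5) ℤ →+* F :=
    (algebraMap (FractionRing (MvPolynomial (Fin 5) ℤ)) F).comp (algebraMap _ _)
  have hf : Function.Injective f :=
    (algebraMap (FractionRing (MvPolynomial (Fin 5) ℤ)) F).injective.comp
      (IsFractionRing.injective _ _)
  have : (universal.map f).IsElliptic := by
    rw [isElliptic_iff, map_Δ, isUnit_iff_ne_zero]
    exact (map_ne_zero_iff f hf).mpr universal_Δ_ne_zero
  have : CharZero F := charZero_of_injective_ringHom hf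
  have h := (universal.map f).defect_eq_zero_of_charZero n
  rw [map_mulDefect, map_addDefect, Polynomial.map_eq_zero_iff hf,
    Polynomial.map_eq_zero_iff hf] at h
  rw [← W.universal_map, map_mulDefect, map_addDefect, h.1, h.2]
  simp

end Universal

end WeierstrassCurve

namespace WeierstrassCurve

open Polynomial Affine.Point

/-! ### The multiplication formula at all points. -/

section MultiplicationFormula

variable {F : Type*} [Field F] {W : WeierstrassCurve F} [DecidableEq F]

/-- `(a : b)` are projective coordinates for the image of `Q` under `x`. -/
def IsXRep (Q : W.toAffine.Point) (a b : F) : Prop :=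
  (Q = 0 → b = 0 ∧ a ≠ 0) ∧ (Q ≠ 0 → b ≠ 0 ∧ a = xCoord Q * b)

omit [DecidableEq F] in
-- At a point of order two the value of `Φ 2` is the square of the x-derivative of the Weierstrass
-- equation. The y-derivative vanishes there, so nonsingularity makes this square nonzero.
lemma Φ_two_eval_ne_zero {x y : F} (h : W.toAffine.Nonsingular x y) (h₂ : W.Ψ₂Sq.eval x = 0) :
    (W.Φ 2).eval x ≠ 0 := by
  rw [Ψ₂Sq_eval h.1, sq_eq_zero_iff] at h₂
  have E := (Affine.equation_iff _ _).mp h.1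
  have e : (W.Φ 2).eval x = (3 * x ^ 2 + 2 * W.a₂ * x + W.a₄ - W.a₁ * y) ^ 2 := by
    simp only [Φ_two, b₄, b₆, b₈]
    simp only [eval_sub, eval_mul, eval_pow, eval_C, eval_X]
    have a₃ : W.a₃ = -2 * y - W.a₁ * x := by linear_combination h₂
    have a₆ : W.a₆ = y ^ 2 + W.a₁ * x * y + W.a₃ * y - (x ^ 3 + W.a₂ * x ^ 2 + W.a₄ * x) := by
      linear_combination -E
    rw [a₆, a₃]
    ring
  rw [e]
  intro h₀
  rcases ((Affine.nonsingular_iff _ _).mp h).2 with h' | h'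
  · exact h' (by linear_combination -(pow_eq_zero_iff two_ne_zero).mp h₀)
  · exact h' (by linear_combination h₂)

/-- Projective coordinates handle the zeros of the division polynomials, where `ψVal_generic` is
silent. The defect identities determine the pair for `n + 2` from those for `n` and `n + 1`; the
cases are whether `(n + 1)P` is `0`, `P`, `-P` or none of these. -/
theorem isXRep_nsmul [W.IsElliptic] {P : W.toAffine.Point} (hP : P ≠ 0) (n : ℕ) :
    IsXRep (n • P) ((W.Φ n).eval (xCoord P)) ((W.ΨSq n).eval (xCoord P)) := by
  induction n using Nat.twoStepInduction with
  | zero => simp [IsXRep]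
  | one => simp [IsXRep, hP]
  | more n ih₀ ih₁ =>
    -- This is the square of `ψ (n + 2) ψ n = x ψ (n + 1) ^ 2 - Φ (n + 1)`. It decides the vanishing
    -- of the new denominator wherever the old one is nonzero.
    have hc : (W.ΨSq (n + 2 : ℕ)).eval (xCoord P) * (W.ΨSq n).eval (xCoord P) =
        ((W.Φ (n + 1 : ℕ)).eval (xCoord P) - xCoord P * (W.ΨSq (n + 1 : ℕ)).eval (xCoord P)) ^ 2 := by
      obtain ⟨y, h, e⟩ := exists_eq_some hP
      rw [Nat.cast_succ n, ψVal_Φ h.1, ← ψVal_sq h.1, ← ψVal_sq h.1, ← Nat.cast_succ, ← ψVal_sq h.1]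
      ring
    have ha := congrArg (eval (xCoord P)) (W.defect_eq_zero n).1
    have hb := congrArg (eval (xCoord P)) (W.defect_eq_zero n).2
    simp only [mulDefect, addDefect, eval_sub, eval_add, eval_mul, eval_pow, eval_X, eval_C,
      eval_ofNat, eval_zero] at ha hb
    generalize (W.Φ n).eval (xCoord P) = A₀ at *
    generalize (W.Φ (n + 1 : ℕ)).eval (xCoord P) = A₁ at *
    generalize (W.Φ (n + 2 : ℕ)).eval (xCoord P) = A₂ at *
    generalize (W.ΨSq n).eval (xCoord P) = B₀ at *
    generalize (W.ΨSq (n + 1 : ℕ)).eval (xCoord P) = B₁ at *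
    generalize (W.ΨSq (n + 2 : ℕ)).eval (xCoord P) = B₂ at *
    have e₂ : (n + 2) • P = (n + 1) • P + P := succ_nsmul _ _
    have e₀ : n • P = (n + 1) • P - P := by rw [succ_nsmul, add_sub_cancel_right]
    rw [e₂]
    rw [e₀] at ih₀
    generalize (n + 1) • P = Q at *
    by_cases hQ : Q = 0
    · obtain ⟨hB₁, hA₁⟩ := ih₁.1 hQ
      subst hB₁ hQ
      rw [zero_sub] at ih₀
      obtain ⟨hB₀, hA₀⟩ := ih₀.2 (neg_ne_zero.mpr hP)
      rw [xCoord_neg] at hA₀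
      rw [zero_add]
      refine ⟨fun h => absurd h hP, fun _ => ⟨?_, ?_⟩⟩
      · intro h
        rw [h] at hc
        exact pow_ne_zero 2 hA₁ (by linear_combination -hc)
      · apply mul_right_cancel₀ hB₀
        subst hA₀
        linear_combination hb - 2 * xCoord P * hc
    obtain ⟨hB₁, hA₁⟩ := ih₁.2 hQ
    subst hA₁
    by_cases hx : xCoord Q = xCoord P
    · rcases eq_or_eq_neg_of_xCoord_eq hQ hP hx with rfl | rfl
      · obtain ⟨hB₀, hA₀⟩ := ih₀.1 (sub_self _)
        subst hB₀
        have e₁ : A₂ * A₀ = (W.Φ 2).eval (xCoord Q) * B₁ ^ 2 := by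
          simp [Φ_two]
          linear_combination ha
        have e₂ : A₀ * B₂ = W.Ψ₂Sq.eval (xCoord Q) * B₁ ^ 2 := by
          simp [Ψ₂Sq]
          linear_combination hb
        constructor
        · intro h
          rw [add_self_eq_zero_iff hQ] at h
          rw [h, zero_mul] at e₂
          refine ⟨(mul_eq_zero.mp e₂).resolve_left hA₀, ?_⟩
          obtain ⟨y, h', -⟩ := exists_eq_some hQ
          intro h₀
          rw [h₀, zero_mul] at e₁
          exact mul_ne_zero (Φ_two_eval_ne_zero h' h) (pow_ne_zero 2 hB₁) e₁.symm
        · intro h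
          have h' := (add_self_eq_zero_iff hQ).not.mp h
          constructor
          · rintro rfl
            rw [mul_zero] at e₂
            exact mul_ne_zero h' (pow_ne_zero 2 hB₁) e₂.symm
          · apply mul_right_cancel₀ hA₀
            rw [e₁, ← xCoord_add_self hQ h]
            linear_combination -xCoord (Q + Q) * e₂
      · rw [neg_add_cancel]
        refine ⟨fun _ => ?_, fun h => absurd rfl h⟩
        by_cases h2 : P + P = 0
        · have h3 : -P - P = 0 := by rw [← neg_eq_zero.mpr h2]; abel
          obtain ⟨hB₀, hA₀⟩ := ih₀.1 h3
          subst hB₀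
          simp only [xCoord_neg] at *
          have e₁ : A₂ * A₀ = (W.Φ 2).eval (xCoord P) * B₁ ^ 2 := by
            simp [Φ_two]
            linear_combination ha
          have e₂ : A₀ * B₂ = W.Ψ₂Sq.eval (xCoord P) * B₁ ^ 2 := by
            simp [Ψ₂Sq]
            linear_combination hb
          rw [add_self_eq_zero_iff hP] at h2
          rw [h2, zero_mul] at e₂
          refine ⟨(mul_eq_zero.mp e₂).resolve_left hA₀, ?_⟩
          obtain ⟨y, h', -⟩ := exists_eq_some hP
          intro h₀
          rw [h₀, zero_mul] at e₁
          exact mul_ne_zero (Φ_two_eval_ne_zero h' h2) (pow_ne_zero 2 hB₁) e₁.symm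
        · have h3 : -P - P ≠ 0 := fun h => h2 (by rw [← neg_eq_zero, ← h]; abel)
          obtain ⟨hB₀, hA₀⟩ := ih₀.2 h3
          rw [xCoord_neg, sub_self, zero_pow two_ne_zero] at hc
          have hB₂ := (mul_eq_zero.mp hc).resolve_right hB₀
          subst hB₂
          refine ⟨rfl, ?_⟩
          rintro rfl
          refine mul_ne_zero ((add_self_eq_zero_iff hP).not.mp h2) (pow_ne_zero 2 hB₁) ?_
          rw [xCoord_neg] at hb
          simp only [Ψ₂Sq, eval_add, eval_mul, eval_C, eval_pow, eval_X]
          linear_combination -hb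
    · obtain ⟨h₂, h₀, a, b⟩ := xCoord_add_sub hQ hP hx
      obtain ⟨hB₀, hA₀⟩ := ih₀.2 h₀
      subst hA₀
      refine ⟨fun h => absurd h h₂, fun _ => ⟨?_, ?_⟩⟩
      · rintro rfl
        rw [zero_mul, ← sub_mul, mul_pow] at hc
        exact mul_ne_zero (pow_ne_zero 2 (sub_ne_zero.mpr hx)) (pow_ne_zero 2 hB₁) hc.symm
      · apply mul_right_cancel₀ hB₀
        linear_combination hb - (xCoord (Q + P) + xCoord (Q - P)) * hc - B₁ ^ 2 * a

lemma nsmul_eq_zero_iff [W.IsElliptic] {P : W.toAffine.Point} (hP : P ≠ 0) (n : ℕ) :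
    n • P = 0 ↔ (W.ΨSq n).eval (xCoord P) = 0 := by
  refine ⟨fun h => ((isXRep_nsmul hP n).1 h).1, fun h => ?_⟩
  by_contra h'
  exact ((isXRep_nsmul hP n).2 h').1 h

lemma xCoord_nsmul [W.IsElliptic] {P : W.toAffine.Point} (hP : P ≠ 0) {n : ℕ} (h : n • P ≠ 0) :
    (W.Φ n).eval (xCoord P) = xCoord (n • P) * (W.ΨSq n).eval (xCoord P) :=
  ((isXRep_nsmul hP n).2 h).2

end MultiplicationFormula

end WeierstrassCurve

namespace WeierstrassCurve

open Polynomial Affine.Point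

/-! ### The number of torsion points, and the roots of the division polynomial. -/

section TorsionCount

lemma monic_Φ_sub {F : Type*} [Field F] (W : WeierstrassCurve F) {n : ℕ} (hn : n ≠ 0) (c : F) :
    (W.Φ n - C c * W.ΨSq n).Monic ∧ (W.Φ n - C c * W.ΨSq n).natDegree = n ^ 2 := by
  have h₀ : (C c * W.ΨSq n).natDegree < (W.Φ n).natDegree := by
    have : 0 < n ^ 2 := by positivity
    rw [natDegree_Φ]
    refine lt_of_le_of_lt ((natDegree_C_mul_le _ _).trans (W.natDegree_ΨSq_le n)) ?_
    simp only [Int.natAbs_natCast]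
    omega
  have h₁ : (C c * W.ΨSq n).degree < (W.Φ n).degree := degree_lt_degree h₀
  have hm : (W.Φ n).Monic := W.leadingCoeff_Φ n
  refine ⟨hm.sub_of_left h₁, ?_⟩
  rw [natDegree_sub_eq_left_of_natDegree_lt, natDegree_Φ, Int.natAbs_natCast]
  exact h₀

/-- The coefficient in degree `2 (n ^ 2 - 1)` is `n ^ 2 * n ^ 2 - (n ^ 2 - 1) * n ^ 2 = n ^ 2`. So
the map `Φ / ΨSq` has only finitely many critical values. -/
lemma wronskian_ne_zero {F : Type*} [Field F] [CharZero F] (W : WeierstrassCurve F) {n : ℕ} (hn : 2 ≤ n) :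
    derivative (W.Φ n) * W.ΨSq n - W.Φ n * derivative (W.ΨSq n) ≠ 0 := by
  obtain ⟨m, hm⟩ : ∃ m, n ^ 2 = m + 2 := ⟨n ^ 2 - 2, by have := Nat.pow_le_pow_left hn 2; omega⟩
  have d₁ : (W.Φ n).natDegree = m + 2 := by rw [natDegree_Φ, Int.natAbs_natCast, hm]
  have d₂ : (W.ΨSq n).natDegree ≤ m + 1 := by
    have := W.natDegree_ΨSq_le n
    rw [Int.natAbs_natCast, hm] at this
    exact this
  have c₁ : (W.Φ n).coeff (m + 2) = 1 := by
    have := W.coeff_Φ n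
    rwa [Int.natAbs_natCast, hm] at this
  have c₂ : (W.ΨSq n).coeff (m + 1) = (m + 2 : ℕ) := by
    have := W.coeff_ΨSq n
    rw [Int.natAbs_natCast, hm] at this
    rw [← hm]
    push_cast at this ⊢
    exact this
  have d₃ : (derivative (W.Φ n)).natDegree ≤ m + 1 :=
    (natDegree_derivative_le _).trans (by rw [d₁]; rfl)
  have d₄ : (derivative (W.ΨSq n)).natDegree ≤ m :=
    (natDegree_derivative_le _).trans (by omega)
  intro h
  have := congrArg (fun f => f.coeff (m + 1 + (m + 1))) h
  simp only [coeff_sub, coeff_zero] at this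
  rw [coeff_mul_add_eq_of_natDegree_le d₃ d₂, show m + 1 + (m + 1) = m + 2 + m by ring,
    coeff_mul_add_eq_of_natDegree_le d₁.le d₄, coeff_derivative, coeff_derivative, c₁, c₂] at this
  have h2 : ((m : F) + 2) = 0 := by
    push_cast at this
    linear_combination this
  exact absurd h2 (by exact_mod_cast (by omega : m + 2 ≠ 0))

lemma nsmul_eq_or_eq_neg_of_root {F : Type*} [Field F] [DecidableEq F] {W : WeierstrassCurve F}
    [W.IsElliptic] {T Q : W.toAffine.Point} (hT : T ≠ 0) (hQ : Q ≠ 0) {n : ℕ}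
    (h : (W.Φ n - C (xCoord Q) * W.ΨSq n).eval (xCoord T) = 0) : n • T = Q ∨ n • T = -Q := by
  rw [eval_sub, eval_mul, eval_C] at h
  have H := isXRep_nsmul hT n
  by_cases h' : n • T = 0
  · obtain ⟨h₁, h₂⟩ := H.1 h'
    rw [h₁, mul_zero, sub_zero] at h
    exact absurd h h₂
  · obtain ⟨h₁, h₂⟩ := H.2 h'
    refine eq_or_eq_neg_of_xCoord_eq h' hQ (mul_right_cancel₀ h₁ ?_)
    linear_combination h - h₂

variable {F : Type*} [Field F] [IsAlgClosed F] {W : WeierstrassCurve F} [W.IsElliptic]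

lemma exists_xCoord_eq (W : WeierstrassCurve F) [W.IsElliptic] (x : F) :
    ∃ P : W.toAffine.Point, P ≠ 0 ∧ xCoord P = x := by
  obtain ⟨y, h⟩ := exists_equation W x
  exact ⟨.some x y (Affine.equation_iff_nonsingular.mp h), some_ne_zero _, rfl⟩

variable [DecidableEq F]

lemma ΨSq_eval_ne_zero_of_Φ_eval_eq_zero {x : F} {n : ℕ} (h : (W.Φ n).eval x = 0) :
    (W.ΨSq n).eval x ≠ 0 := by
  obtain ⟨P, hP, rfl⟩ := exists_xCoord_eq W x
  have H := isXRep_nsmul hP n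
  by_cases h' : n • P = 0
  · exact absurd h (H.1 h').2
  · exact (H.2 h').1

variable [CharZero F]

/-- The kernel of multiplication by `n` is in bijection with any nonempty fibre. Over a general
point `Q` the fibre is counted by the roots of the monic polynomial `Φ n - x(Q) ΨSq n` of degree `n
^ 2`. -/
lemma ncard_torsion (W : WeierstrassCurve F) [W.IsElliptic] {n : ℕ} (hn : 2 ≤ n) :
    {P : W.toAffine.Point | n • P = 0}.ncard = n ^ 2 := by
  have hw := wronskian_ne_zero W hn
  set w := derivative (W.Φ n) * W.ΨSq n - W.Φ n * derivative (W.ΨSq n)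
  -- Avoiding the critical values makes the roots simple, since a double root is a zero of the
  -- Wronskian. Avoiding the roots of `Ψ₂Sq` gives `Q ≠ -Q`, so that the x-coordinate is injective
  -- on the fibre over `Q`.
  obtain ⟨c, hc⟩ := Infinite.exists_notMem_finset
    (w.roots.toFinset.image (fun x => (W.Φ n).eval x / (W.ΨSq n).eval x) ∪ W.Ψ₂Sq.roots.toFinset)
  rw [Finset.mem_union, not_or] at hc
  obtain ⟨hc₁, hc₂⟩ := hc
  obtain ⟨Q, hQ, rfl⟩ := exists_xCoord_eq W c
  have hQQ : Q ≠ -Q := by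
    intro h
    apply hc₂
    rw [Multiset.mem_toFinset, mem_roots (W.Ψ₂Sq_ne_zero (by norm_num)), IsRoot.def,
      ← add_self_eq_zero_iff hQ]
    exact eq_neg_iff_add_eq_zero.mp h
  obtain ⟨hm, hd⟩ := monic_Φ_sub W (show n ≠ 0 by omega) (xCoord Q)
  set f := W.Φ n - C (xCoord Q) * W.ΨSq n with hf
  have hnod : f.roots.Nodup := by
    rw [Multiset.nodup_iff_count_le_one]
    intro x
    by_contra h
    rw [count_roots, not_le, one_lt_rootMultiplicity_iff_isRoot hm.ne_zero] at h
    obtain ⟨h₁, h₂⟩ := h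
    simp only [hf, IsRoot.def, eval_sub, eval_mul, eval_C, derivative_sub, derivative_mul,
      derivative_C, zero_mul, zero_add] at h₁ h₂
    have h₃ : (W.ΨSq n).eval x ≠ 0 := by
      intro h₀
      rw [h₀, mul_zero, sub_zero] at h₁
      exact ΨSq_eval_ne_zero_of_Φ_eval_eq_zero h₁ h₀
    apply hc₁
    refine Finset.mem_image.mpr ⟨x, ?_, ?_⟩
    · rw [Multiset.mem_toFinset, mem_roots hw, IsRoot.def]
      simp only [w, eval_sub, eval_mul]
      linear_combination (W.ΨSq n).eval x * h₂ - (derivative (W.ΨSq n)).eval x * h₁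
    · rw [div_eq_iff h₃]
      linear_combination h₁
  have hcard : f.roots.toFinset.card = n ^ 2 := by
    rw [Multiset.toFinset_card_of_nodup hnod, ← hd]
    exact (IsAlgClosed.splits f).natDegree_eq_card_roots.symm
  have hT0 : ∀ T : W.toAffine.Point, n • T = Q → T ≠ 0 := by
    rintro T h rfl
    exact hQ (by rw [← h, nsmul_zero])
  have himg : xCoord '' {T : W.toAffine.Point | n • T = Q} = f.roots.toFinset := by
    ext x
    simp only [Set.mem_image, Set.mem_ofPred_eq, Finset.mem_coe, Multiset.mem_toFinset,
      mem_roots hm.ne_zero, IsRoot.def]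
    constructor
    · rintro ⟨T, hT, rfl⟩
      have := xCoord_nsmul (hT0 T hT) (n := n) (by rwa [hT])
      rw [hT] at this
      rw [hf, eval_sub, eval_mul, eval_C, this, sub_self]
    · intro h
      obtain ⟨T, hT, rfl⟩ := exists_xCoord_eq W x
      rcases nsmul_eq_or_eq_neg_of_root hT hQ h with h | h
      · exact ⟨T, h, rfl⟩
      · exact ⟨-T, by rw [smul_neg, h, neg_neg], xCoord_neg T⟩
  have hinj : Set.InjOn xCoord {T : W.toAffine.Point | n • T = Q} := by
    intro T hT T' hT' h
    refine (eq_or_eq_neg_of_xCoord_eq (hT0 T hT) (hT0 T' hT') h).resolve_right fun h' => hQQ ?_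
    rw [← hT', ← smul_neg, ← h', hT, hT']
  have hfib : {T : W.toAffine.Point | n • T = Q}.ncard = n ^ 2 := by
    rw [← hinj.ncard_image, himg, Set.ncard_coe_finset, hcard]
  obtain ⟨T, hT⟩ : {T : W.toAffine.Point | n • T = Q}.Nonempty := by
    rw [Set.nonempty_iff_ne_empty]
    intro h
    rw [h, Set.ncard_empty] at hfib
    exact absurd hfib (by positivity)
  rw [← hfib, ← Set.ncard_image_of_injective _ (add_right_injective T)]
  congr 1
  ext S
  simp only [Set.mem_image, Set.mem_ofPred_eq] at hT ⊢
  constructor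
  · rintro ⟨P, hP, rfl⟩
    rw [smul_add, hT, hP, add_zero]
  · intro h
    exact ⟨S - T, by rw [smul_sub, h, hT, sub_self], add_sub_cancel _ _⟩

lemma finite_torsion (W : WeierstrassCurve F) [W.IsElliptic] {n : ℕ} (hn : n ≠ 0) :
    {P : W.toAffine.Point | n • P = 0}.Finite := by
  rcases (show n = 1 ∨ 2 ≤ n by omega) with rfl | h
  · simp
  · exact Set.finite_of_ncard_ne_zero (by rw [ncard_torsion W h]; positivity)

/-- The nonzero points killed by `n`. -/
def nonzeroTorsion (W : WeierstrassCurve F) [W.IsElliptic] (n : ℕ) : Finset W.toAffine.Point :=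
  if h : n = 0 then ∅ else (finite_torsion W h).toFinset.erase 0

lemma mem_nonzeroTorsion {n : ℕ} (hn : n ≠ 0) {P : W.toAffine.Point} :
    P ∈ nonzeroTorsion W n ↔ P ≠ 0 ∧ n • P = 0 := by
  simp [nonzeroTorsion, hn]

lemma card_nonzeroTorsion {n : ℕ} (hn : 2 ≤ n) : (nonzeroTorsion W n).card = n ^ 2 - 1 := by
  rw [nonzeroTorsion, dif_neg (by omega), Finset.card_erase_of_mem (by simp),
    ← Set.ncard_eq_toFinset_card _ _, ncard_torsion W hn]

/-- Each fibre of the x-coordinate is `{P, -P}`. For odd `p` the polynomial is a square, so its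
roots have multiplicity at least two; for `p = 2` the fibre is a single point. This gives one
inclusion of multisets, and the degree bound `p ^ 2 - 1` gives equality. -/
lemma ΨSq_roots {p : ℕ} (hp : p.Prime) :
    (W.ΨSq p).roots = (nonzeroTorsion W p).val.map xCoord := by
  have hp0 : (p : F) ≠ 0 := by exact_mod_cast hp.ne_zero
  have h0 : W.ΨSq p ≠ 0 := W.ΨSq_ne_zero (by exact_mod_cast hp0)
  symm
  refine Multiset.eq_of_le_of_card_le (Multiset.le_iff_count.mpr fun a => ?_) ?_
  · rw [Multiset.count_map]
    by_cases ha : ∃ P ∈ nonzeroTorsion W p, a = xCoord P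
    · obtain ⟨P, hP, rfl⟩ := ha
      obtain ⟨hP₁, hP₂⟩ := (mem_nonzeroTorsion hp.ne_zero).mp hP
      have hroot := (nsmul_eq_zero_iff hP₁ p).mp hP₂
      have hsub : (nonzeroTorsion W p).filter (fun Q => xCoord P = xCoord Q) ⊆ {P, -P} := by
        intro Q hQ
        obtain ⟨hQ₁, hQ₂⟩ := Finset.mem_filter.mp hQ
        rcases eq_or_eq_neg_of_xCoord_eq ((mem_nonzeroTorsion hp.ne_zero).mp hQ₁).1 hP₁ hQ₂.symm
          with h | h <;> simp [h]
      refine (Finset.card_le_card hsub).trans ?_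
      rcases hp.eq_two_or_odd' with rfl | hodd
      · have : -P = P := by
          rw [two_nsmul] at hP₂
          exact (eq_neg_of_add_eq_zero_left hP₂).symm
        rw [this, Finset.pair_eq_singleton, Finset.card_singleton, Nat.one_le_iff_ne_zero,
          Multiset.count_ne_zero, mem_roots h0]
        exact hroot
      · refine Finset.card_le_two.trans ?_
        have e : W.ΨSq p = W.preΨ' p ^ 2 := by
          rw [ΨSq_ofNat, if_neg (Nat.not_even_iff_odd.mpr hodd), mul_one]
        rw [e, roots_pow, Multiset.count_nsmul]
        have : 1 ≤ Multiset.count (xCoord P) (W.preΨ' p).roots := by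
          rw [Nat.one_le_iff_ne_zero, Multiset.count_ne_zero, mem_roots (W.preΨ'_ne_zero hp0)]
          rw [e, eval_pow] at hroot
          exact pow_eq_zero_iff two_ne_zero |>.mp hroot
        omega
    · rw [Multiset.filter_eq_nil.mpr fun P hP h => ha ⟨P, hP, h⟩]
      simp
  · rw [Multiset.card_map, Finset.card_val, card_nonzeroTorsion hp.two_le]
    refine (card_roots' _).trans ?_
    simpa using W.natDegree_ΨSq_le p

end TorsionCount

end WeierstrassCurve

namespace WeierstrassCurve

open Polynomial Affine.Point

/-! ### Valuations of values of polynomials. -/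

section PolynomialValuation

variable {F : Type*} [Field F] {Γ : Type*} [LinearOrderedCommGroupWithZero Γ] (v : Valuation F Γ)

lemma valuation_eval_le_one {f : F[X]} (hf : ∀ i, v (f.coeff i) ≤ 1) {x : F} (hx : v x ≤ 1) :
    v (f.eval x) ≤ 1 := by
  rw [eval_eq_sum_range]
  refine v.map_sum_le fun i _ => ?_
  rw [map_mul, map_pow]
  exact mul_le_one' (hf i) (pow_le_one' hx i)

lemma valuation_eval_eq_one {f : F[X]} (h0 : v (f.coeff 0) = 1)
    (hf : ∀ i, i ≠ 0 → v (f.coeff i) < 1) {x : F} (hx : v x ≤ 1) : v (f.eval x) = 1 := by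
  rw [eval_eq_sum_range, Finset.sum_range_succ', pow_zero, mul_one, ← h0]
  refine v.map_add_eq_of_lt_right ?_
  rw [h0]
  refine v.map_sum_lt one_ne_zero fun i _ => ?_
  rw [map_mul, map_pow]
  exact mul_lt_one_of_lt_of_le (hf _ (Nat.succ_ne_zero i)) (pow_le_one' hx _)

lemma valuation_eval_of_monic {f : F[X]} (hm : f.Monic) (hf : ∀ i, v (f.coeff i) ≤ 1) {x : F}
    (hx : 1 < v x) : v (f.eval x) = v x ^ f.natDegree := by
  rw [eval_eq_sum_range, Finset.sum_range_succ, hm.coeff_natDegree, one_mul, ← map_pow]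
  refine v.map_add_eq_of_lt_right ?_
  have hx0 : v x ≠ 0 := (zero_lt_one.trans hx).ne'
  refine v.map_sum_lt (by rw [map_pow]; exact pow_ne_zero _ hx0) fun i hi => ?_
  rw [map_mul, map_pow, map_pow]
  refine lt_of_le_of_lt (mul_le_of_le_one_left' (hf i)) ?_
  exact pow_lt_pow_right₀ hx (Finset.mem_range.mp hi)

lemma valuation_eval_eq_prod [IsAlgClosed F] (f : F[X]) (x : F) :
    v (f.eval x) = v f.leadingCoeff * (f.roots.map (fun r => v (x - r))).prod := by
  conv_lhs => rw [(IsAlgClosed.splits f).eq_prod_roots]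
  rw [eval_mul, eval_C, map_mul, eval_multiset_prod, Multiset.map_map, map_multiset_prod,
    Multiset.map_map]
  congr 3
  ext r
  simp

end PolynomialValuation

/-! ### The filtration of the kernel of reduction. -/

section KernelOfReduction

variable {F : Type*} [Field F] {Γ : Type*} [LinearOrderedCommGroupWithZero Γ] {v : Valuation F Γ}

/-- Three points on a line in a Weierstrass curve with integral coefficients. -/
lemma le_valuation_third_root {a₁ a₂ a₃ a₄ a₆ x₁ x₂ x₃ l m : F} {c : Γ}
    (h₁ : v a₁ ≤ 1) (h₂ : v a₂ ≤ 1) (h₃ : v a₃ ≤ 1) (h₄ : v a₄ ≤ 1) (h₆ : v a₆ ≤ 1)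
    (e₁ : x₁ + x₂ + x₃ = l ^ 2 + a₁ * l - a₂)
    (e₂ : x₁ * x₂ + x₁ * x₃ + x₂ * x₃ = a₄ - 2 * l * m - a₁ * m - a₃ * l)
    (e₃ : x₁ * x₂ * x₃ = m ^ 2 + a₃ * m - a₆)
    (hc : 1 < c) (hx₁ : c ≤ v x₁) (hx₂ : c ≤ v x₂) : c ≤ v x₃ := by
  wlog h : v x₂ ≤ v x₁ generalizing x₁ x₂
  · exact this (by rw [← e₁]; ring) (by rw [← e₂]; ring) (by rw [← e₃]; ring) hx₂ hx₁
      (not_le.mp h).le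
  -- If the third root were smaller than `c`, then `x₁ x₂` would dominate the second symmetric
  -- function. But the first and third symmetric functions bound `v l ^ 2` by `v x₁` and `v m ^ 2`
  -- by less than `c v x₁ v x₂`, which makes every term on the right of `e₂` too small.
  by_contra! hx₃
  have c0 : 0 < c := zero_lt_one.trans hc
  have p₁ : 0 < v x₁ := c0.trans_le hx₁
  have p₂ : 0 < v x₂ := c0.trans_le hx₂
  have g₁ : 1 < v x₁ := hc.trans_le hx₁
  have g₂ : 1 < v x₂ := hc.trans_le hx₂
  have sqle : ∀ z : Γ, z ^ 2 ≤ z → z ≤ 1 := by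
    intro z hz
    by_contra! h'
    have : z * 1 < z * z := mul_lt_mul_of_pos_left h' (zero_lt_one.trans h')
    rw [mul_one, ← sq] at this
    exact absurd hz (not_le.mpr this)
  have hl : v l ^ 2 ≤ v x₁ := by
    have e : l ^ 2 = x₁ + x₂ + x₃ - a₁ * l + a₂ := by linear_combination -e₁
    by_contra! hlt
    have b : v l ^ 2 ≤ max (max (v x₁) (v l)) 1 := by
      rw [← map_pow, e]
      refine (v.map_add _ _).trans (max_le_max ((v.map_sub _ _).trans (max_le_max ?_ ?_)) h₂)
      · refine (v.map_add _ _).trans (max_le ((v.map_add _ _).trans (max_le le_rfl h)) ?_)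
        exact hx₃.le.trans hx₁
      · rw [map_mul]
        exact mul_le_of_le_one_left' h₁
    have : v l ≤ 1 := by
      rcases le_max_iff.mp b with b | b
      · rcases le_max_iff.mp b with b | b
        · exact absurd b (not_le.mpr hlt)
        · exact sqle _ b
      · exact (pow_le_one_iff_of_nonneg zero_le two_ne_zero).mp b
    exact absurd (hlt.trans_le (pow_le_one' this 2)) (not_lt.mpr g₁.le)
  have g₁₂ : 1 < v x₁ * v x₂ := one_lt_mul'' g₁ g₂
  have hm : v m ^ 2 < c * (v x₁ * v x₂) := by
    have e : m ^ 2 = x₁ * x₂ * x₃ - a₃ * m + a₆ := by linear_combination -e₃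
    have g : 1 < c * (v x₁ * v x₂) := one_lt_mul'' hc g₁₂
    have b : v m ^ 2 ≤ max (max (v x₁ * v x₂ * v x₃) (v m)) 1 := by
      conv_lhs => rw [← map_pow, e]
      refine (v.map_add _ _).trans (max_le_max ((v.map_sub _ _).trans (max_le_max ?_ ?_)) h₆)
      · rw [map_mul, map_mul]
      · rw [map_mul]
        exact mul_le_of_le_one_left' h₃
    rcases le_max_iff.mp b with b | b
    · rcases le_max_iff.mp b with b | b
      · refine b.trans_lt ?_
        rw [mul_comm c]
        exact mul_lt_mul_of_pos_left hx₃ (mul_pos p₁ p₂)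
      · exact (pow_le_one' (sqle _ b) 2).trans_lt g
    · exact b.trans_lt g
  have hle : v x₁ * v x₂ ≤ max (max (max 1 (v l * v m)) (v m)) (v l) := by
    have e : v x₁ * v x₂ = v (x₁ * x₂ + x₁ * x₃ + x₂ * x₃) := by
      rw [← map_mul, add_assoc]
      refine (v.map_add_eq_of_lt_left ?_).symm
      refine v.map_add_lt ?_ ?_
      · rw [map_mul, map_mul]
        exact mul_lt_mul_of_pos_left (hx₃.trans_le hx₂) p₁
      · rw [map_mul, map_mul, mul_comm (v x₁)]
        exact mul_lt_mul_of_pos_left (hx₃.trans_le hx₁) p₂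
    rw [e, e₂]
    have two : v 2 ≤ 1 := by
      rw [← one_add_one_eq_two]
      exact (v.map_add _ _).trans (by simp)
    refine (v.map_sub _ _).trans (max_le_max ((v.map_sub _ _).trans (max_le_max
      ((v.map_sub _ _).trans (max_le_max h₄ ?_)) ?_)) ?_)
    · rw [map_mul, map_mul, mul_assoc]
      exact mul_le_of_le_one_left' two
    · rw [map_mul]
      exact mul_le_of_le_one_left' h₁
    · rw [map_mul]
      exact mul_le_of_le_one_left' h₃
  have hsq : ∀ z : Γ, z ^ 2 < (v x₁ * v x₂) ^ 2 → z < v x₁ * v x₂ := fun z hz =>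
    lt_of_pow_lt_pow_left₀ 2 zero_le hz
  have b₁ : v x₁ < (v x₁ * v x₂) ^ 2 := by
    calc v x₁ < v x₁ * v x₂ := by simpa using mul_lt_mul_of_pos_left g₂ p₁
      _ < (v x₁ * v x₂) ^ 2 := by
        rw [sq]; simpa using mul_lt_mul_of_pos_left g₁₂ (zero_lt_one.trans g₁₂)
  have b₂ : v m ^ 2 < (v x₁ * v x₂) ^ 2 := by
    refine hm.trans_le ?_
    rw [sq]
    refine mul_le_mul_left ?_ _
    exact hx₁.trans (by simpa using mul_le_mul_right g₂.le (v x₁))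
  have b₃ : (v l * v m) ^ 2 < (v x₁ * v x₂) ^ 2 := by
    calc (v l * v m) ^ 2 = v l ^ 2 * v m ^ 2 := mul_pow _ _ _
      _ ≤ v x₁ * v m ^ 2 := mul_le_mul_left hl _
      _ < v x₁ * (c * (v x₁ * v x₂)) := mul_lt_mul_of_pos_left hm p₁
      _ = (v x₁ * c) * (v x₁ * v x₂) := (mul_assoc _ _ _).symm
      _ ≤ (v x₁ * v x₂) * (v x₁ * v x₂) := mul_le_mul_left (mul_le_mul_right hx₂ _) _
      _ = _ := (sq _).symm
  refine absurd hle (not_le.mpr (max_lt (max_lt (max_lt g₁₂ ?_) ?_) ?_))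
  · exact hsq _ b₃
  · exact hsq _ b₂
  · exact hsq _ (hl.trans_lt b₁)

/-- The curve has coefficients that are integral for `v`. -/
structure IsIntegralAt (v : Valuation F Γ) (W : WeierstrassCurve F) : Prop where
  a₁ : v W.a₁ ≤ 1
  a₂ : v W.a₂ ≤ 1
  a₃ : v W.a₃ ≤ 1
  a₄ : v W.a₄ ≤ 1
  a₆ : v W.a₆ ≤ 1

/-- The x-coordinates of `P`, `Q` and `P + Q` are those of the three intersections of the curve with
a line. This closure under addition replaces the filtration of the formal group. -/
lemma le_valuation_xCoord_add [DecidableEq F] {W : WeierstrassCurve F} (hW : W.IsIntegralAt v)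
    {c : Γ} (hc : 1 < c) {P Q : W.toAffine.Point} (hP : P ≠ 0) (hQ : Q ≠ 0) (hPQ : P + Q ≠ 0)
    (h₁ : c ≤ v (xCoord P)) (h₂ : c ≤ v (xCoord Q)) : c ≤ v (xCoord (P + Q)) := by
  obtain ⟨y₁, hy₁, eP⟩ := exists_eq_some hP
  obtain ⟨y₂, hy₂, eQ⟩ := exists_eq_some hQ
  generalize xCoord P = x₁ at *
  generalize xCoord Q = x₂ at *
  subst eP eQ
  by_cases hxy : x₁ = x₂ ∧ y₁ = W.toAffine.negY x₂ y₂
  · exact absurd (add_of_Y_eq hxy.1 hxy.2) hPQ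
  rw [add_some hxy, xCoord_some]
  have H := Affine.addPolynomial_slope hy₁.1 hy₂.1 hxy
  rw [Affine.addPolynomial_eq, neg_inj, Cubic.prod_X_sub_C_eq, Cubic.toPoly_injective,
    Cubic.mk.injEq] at H
  obtain ⟨-, -, e₂, e₃⟩ := H
  refine le_valuation_third_root (l := W.toAffine.slope x₁ x₂ y₁ y₂)
    (m := y₁ - W.toAffine.slope x₁ x₂ y₁ y₂ * x₁) hW.a₁ hW.a₂ hW.a₃ hW.a₄ hW.a₆ ?_ ?_ ?_ hc h₁ h₂
  · rw [Affine.addX]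
    ring
  · linear_combination -e₂
  · linear_combination e₃

end KernelOfReduction

end WeierstrassCurve

namespace WeierstrassCurve

open Polynomial
open Affine.Point hiding map_zero neg_zero

set_option linter.unusedSectionVars false

/-! ### Distances of `p`-power torsion points from the origin. -/

section Supersingular

/-- The curve has coefficients that are integral for `v`, and modulo the maximal ideal of `v` its
division polynomial `ΨSq p` becomes a nonzero constant. -/
structure IsSupersingularAt {F : Type*} [Field F] {Γ : Type*} [LinearOrderedCommGroupWithZero Γ]
    (v : Valuation F Γ) (W : WeierstrassCurve F) (p : ℕ) : Prop where
  integral : W.IsIntegralAt v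
  prime : p.Prime
  lt_one : v p < 1
  Φ_le : ∀ i, v ((W.Φ p).coeff i) ≤ 1
  ΨSq_zero : v ((W.ΨSq p).coeff 0) = 1
  ΨSq_lt : ∀ i, i ≠ 0 → v ((W.ΨSq p).coeff i) < 1

variable {F : Type*} [Field F] [IsAlgClosed F] [CharZero F] [DecidableEq F]
  {Γ : Type*} [LinearOrderedCommGroupWithZero Γ] {v : Valuation F Γ}
  {W : WeierstrassCurve F} [W.IsElliptic] {p : ℕ}

lemma valuation_ΨSq_eval (hp : p.Prime) (x : F) :
    v ((W.ΨSq p).eval x) = v p ^ 2 * ∏ S ∈ nonzeroTorsion W p, v (x - xCoord S) := by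
  have hp0 : ((p : ℤ) : F) ≠ 0 := by exact_mod_cast hp.ne_zero
  rw [valuation_eval_eq_prod, ΨSq_roots hp, W.leadingCoeff_ΨSq hp0, Multiset.map_map]
  simp only [map_pow, Int.cast_natCast]
  rfl

namespace IsSupersingularAt

lemma valuation_pos (h : W.IsSupersingularAt v p) : 0 < v p := by
  rw [Valuation.pos_iff]
  exact_mod_cast h.prime.ne_zero

lemma mem_torsion (h : W.IsSupersingularAt v p) {P : W.toAffine.Point} :
    P ∈ nonzeroTorsion W p ↔ P ≠ 0 ∧ p • P = 0 :=
  mem_nonzeroTorsion h.prime.ne_zero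

lemma card_torsion (h : W.IsSupersingularAt v p) : (nonzeroTorsion W p).card = p ^ 2 - 1 :=
  card_nonzeroTorsion h.prime.two_le

lemma one_lt_of_mem (h : W.IsSupersingularAt v p) {S : W.toAffine.Point}
    (hS : S ∈ nonzeroTorsion W p) : 1 < v (xCoord S) := by
  by_contra! hx
  obtain ⟨h₁, h₂⟩ := h.mem_torsion.mp hS
  have := valuation_eval_eq_one v h.ΨSq_zero h.ΨSq_lt hx
  rw [(nsmul_eq_zero_iff h₁ p).mp h₂, map_zero] at this
  exact zero_ne_one this

/-- The factorisation of `ΨSq p` evaluated at `0`, where its value is a unit. -/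
lemma prod_valuation_xCoord (h : W.IsSupersingularAt v p) :
    v p ^ 2 * ∏ S ∈ nonzeroTorsion W p, v (xCoord S) = 1 := by
  have := valuation_ΨSq_eval (v := v) (W := W) h.prime 0
  rw [← coeff_zero_eq_eval_zero, h.ΨSq_zero] at this
  simpa using this.symm

lemma one_lt_of_one_lt_nsmul (h : W.IsSupersingularAt v p) {T : W.toAffine.Point}
    (hT : p • T ≠ 0) (hx : 1 < v (xCoord (p • T))) : 1 < v (xCoord T) := by
  have hT0 : T ≠ 0 := by rintro rfl; exact hT (nsmul_zero p)
  by_contra! hle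
  have e := congrArg v (xCoord_nsmul hT0 hT)
  rw [map_mul, valuation_eval_eq_one v h.ΨSq_zero h.ΨSq_lt hle, mul_one] at e
  exact absurd (valuation_eval_le_one v h.Φ_le hle) (by rw [e]; exact not_le.mpr hx)

/-- For `v(x) > 1` the leading term of the monic integral polynomial `Φ p` of degree `p ^ 2`
dominates. -/
lemma valuation_nsmul (h : W.IsSupersingularAt v p) {T : W.toAffine.Point}
    (hT : p • T ≠ 0) (hx : 1 < v (xCoord T)) :
    v (xCoord (p • T)) * v ((W.ΨSq p).eval (xCoord T)) = v (xCoord T) ^ p ^ 2 := by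
  have hT0 : T ≠ 0 := by rintro rfl; exact hT (nsmul_zero p)
  rw [← map_mul, ← xCoord_nsmul hT0 hT,
    valuation_eval_of_monic v (W.leadingCoeff_Φ p) h.Φ_le hx, natDegree_Φ, Int.natAbs_natCast]

lemma one_lt_of_pow_nsmul (h : W.IsSupersingularAt v p) {T : W.toAffine.Point} (hT : T ≠ 0) {n : ℕ}
    (hn : p ^ n • T = 0) : 1 < v (xCoord T) := by
  induction n generalizing T with
  | zero => exact absurd (by simpa using hn) hT
  | succ n ih =>
    by_cases h' : p • T = 0
    · exact h.one_lt_of_mem (h.mem_torsion.mpr ⟨hT, h'⟩)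
    · refine h.one_lt_of_one_lt_nsmul h' (ih h' ?_)
      rwa [smul_smul, ← pow_succ]

lemma one_lt_of_addOrderOf (h : W.IsSupersingularAt v p) {T : W.toAffine.Point} {n : ℕ}
    (hn : n ≠ 0) (hT : addOrderOf T = p ^ n) : 1 < v (xCoord T) := by
  refine h.one_lt_of_pow_nsmul (n := n) ?_ (by rw [← hT, addOrderOf_nsmul_eq_zero])
  rintro rfl
  rw [addOrderOf_zero] at hT
  exact absurd hT (Nat.one_lt_pow hn h.prime.one_lt).ne

lemma mem_of_addOrderOf (h : W.IsSupersingularAt v p) {T : W.toAffine.Point} 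
    (hT : addOrderOf T = p) : T ∈ nonzeroTorsion W p := by
  refine h.mem_torsion.mpr ⟨?_, by rw [← addOrderOf_dvd_iff_nsmul_eq_zero, hT]⟩
  rintro rfl
  rw [addOrderOf_zero] at hT
  exact h.prime.one_lt.ne hT

lemma addOrderOf_of_mem (h : W.IsSupersingularAt v p) {T : W.toAffine.Point}
    (hT : T ∈ nonzeroTorsion W p) : addOrderOf T = p := by
  obtain ⟨h₁, h₂⟩ := h.mem_torsion.mp hT
  have := Fact.mk h.prime
  exact addOrderOf_eq_prime h₂ h₁

lemma addOrderOf_nsmul_prime (h : W.IsSupersingularAt v p) {T : W.toAffine.Point} {n : ℕ}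
    (hT : addOrderOf T = p ^ (n + 1)) : addOrderOf (p • T) = p ^ n := by
  rw [addOrderOf_nsmul' _ h.prime.ne_zero, hT, Nat.gcd_eq_right (dvd_pow_self p n.succ_ne_zero),
    pow_succ, Nat.mul_div_cancel _ h.prime.pos]

/-- With the origin added, these points form a subgroup of the `p`-torsion, whose order divides `p ^
2`. -/
lemma card_filter (h : W.IsSupersingularAt v p) {c : Γ} (hc : 1 < c) :
    ∃ j ≤ 2, ((nonzeroTorsion W p).filter (fun S => c ≤ v (xCoord S))).card + 1 = p ^ j := by
  let E : AddSubgroup W.toAffine.Point := (nsmulAddMonoidHom p).ker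
  have hE : ∀ P, P ∈ E ↔ p • P = 0 := fun P => Iff.rfl
  have cE : Nat.card E = p ^ 2 := ncard_torsion W h.prime.two_le
  let H : AddSubgroup W.toAffine.Point :=
    { carrier := {P | p • P = 0 ∧ (P ≠ 0 → c ≤ v (xCoord P))}
      zero_mem' := ⟨nsmul_zero p, fun h => absurd rfl h⟩
      add_mem' := by
        rintro P Q ⟨hP, hP'⟩ ⟨hQ, hQ'⟩
        refine ⟨by rw [nsmul_add, hP, hQ, add_zero], fun hPQ => ?_⟩
        by_cases hP0 : P = 0
        · subst hP0
          rw [zero_add] at hPQ ⊢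
          exact hQ' hPQ
        by_cases hQ0 : Q = 0
        · subst hQ0
          rw [add_zero] at hPQ ⊢
          exact hP' hPQ
        exact le_valuation_xCoord_add h.integral hc hP0 hQ0 hPQ (hP' hP0) (hQ' hQ0)
      neg_mem' := by
        rintro P ⟨hP, hP'⟩
        refine ⟨by rw [smul_neg, hP, neg_zero], fun h => ?_⟩
        rw [xCoord_neg]
        exact hP' (by rintro rfl; exact h neg_zero) }
  have hHE : H ≤ E := fun P hP => hP.1
  obtain ⟨j, hj, e⟩ := (Nat.dvd_prime_pow h.prime).mp (cE ▸ AddSubgroup.card_dvd_of_le hHE)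
  refine ⟨j, hj, ?_⟩
  rw [← e]
  have : (H : Set W.toAffine.Point) =
      insert 0 ((nonzeroTorsion W p).filter (fun S => c ≤ v (xCoord S))) := by
    ext P
    simp only [Finset.mem_coe, Finset.mem_insert, Finset.mem_filter,
      h.mem_torsion]
    change (p • P = 0 ∧ (P ≠ 0 → c ≤ v (xCoord P))) ↔ _
    by_cases hP : P = 0
    · simp [hP]
    · simp [hP]
  change _ = (H : Set W.toAffine.Point).ncard
  rw [this, Set.ncard_coe_finset, Finset.card_insert_of_notMem]
  simp [h.mem_torsion]

/-- The subgroup of points at least as close to the origin as `S` is nontrivial, so it has at least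
`p` elements. -/
lemma sub_one_le_card_filter (h : W.IsSupersingularAt v p) {S : W.toAffine.Point}
    (hS : S ∈ nonzeroTorsion W p) :
    p - 1 ≤ ((nonzeroTorsion W p).filter (fun T => v (xCoord S) ≤ v (xCoord T))).card := by
  obtain ⟨j, -, e⟩ := h.card_filter (h.one_lt_of_mem hS)
  have : 0 < ((nonzeroTorsion W p).filter (fun T => v (xCoord S) ≤ v (xCoord T))).card :=
    Finset.card_pos.mpr ⟨S, Finset.mem_filter.mpr ⟨hS, le_rfl⟩⟩
  have hj : j ≠ 0 := by
    rintro rfl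
    rw [pow_zero] at e
    omega
  have := Nat.le_self_pow hj p
  omega

lemma torsion_nonempty (h : W.IsSupersingularAt v p) : (nonzeroTorsion W p).Nonempty := by
  rw [← Finset.card_pos, h.card_torsion]
  have := Nat.pow_le_pow_left h.prime.two_le 2
  omega

/-- If all points of order `p` are equally far from the origin, then so are all points of order
`p ^ n`. -/
lemma valuation_pow_of_forall_eq (h : W.IsSupersingularAt v p)
    (hE : ∀ R ∈ nonzeroTorsion W p, ∀ Q ∈ nonzeroTorsion W p, v (xCoord R) = v (xCoord Q))
    {n : ℕ} {T : W.toAffine.Point} (hT : addOrderOf T = p ^ (n + 1)) :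
    v p ^ 2 * v (xCoord T) ^ ((p ^ 2 - 1) * p ^ (2 * n)) = 1 := by
  obtain ⟨R, hR⟩ := h.torsion_nonempty
  have hprod : v p ^ 2 * v (xCoord R) ^ (p ^ 2 - 1) = 1 := by
    rw [← h.prod_valuation_xCoord, Finset.prod_congr rfl fun S hS => hE S hS R hR,
      Finset.prod_const, h.card_torsion]
  induction n generalizing T with
  | zero =>
    rw [zero_add, pow_one] at hT
    rw [hE T (h.mem_of_addOrderOf hT) R hR, mul_zero, pow_zero, mul_one, hprod]
  | succ n ih =>
    have hQ := h.addOrderOf_nsmul_prime hT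
    have hpQ := ih hQ
    have hx := h.one_lt_of_addOrderOf n.succ.succ_ne_zero hT
    have hxQ := h.one_lt_of_addOrderOf n.succ_ne_zero hQ
    have hQ0 : p • T ≠ 0 := by
      intro h0
      rw [h0, addOrderOf_zero] at hQ
      exact absurd hQ (Nat.one_lt_pow n.succ_ne_zero h.prime.one_lt).ne
    have e := h.valuation_nsmul hQ0 hx
    have hp2 := Nat.pow_le_pow_left h.prime.two_le 2
    -- Otherwise every factor of `ΨSq p` at `x(T)` is at most `v(x(T))`, whence `v(x(T)) ≤ v(p)^2
    -- v(x(pT)) ≤ 1` by the induction hypothesis. Once `x(T)` is smaller than all the roots, `ΨSq p`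
    -- has a unit value there and `v(x(pT)) = v(x(T))^(p^2)`.
    have hlt : v (xCoord T) < v (xCoord R) := by
      by_contra! hle
      have b : v ((W.ΨSq p).eval (xCoord T)) ≤ v p ^ 2 * v (xCoord T) ^ (p ^ 2 - 1) := by
        rw [valuation_ΨSq_eval h.prime, ← h.card_torsion, ← Finset.prod_const]
        refine mul_le_mul_right (Finset.prod_le_prod' fun S hS => ?_) _
        exact v.map_sub_le le_rfl ((hE S hS R hR).trans_le hle)
      have b₂ : v (xCoord T) ≤ v p ^ 2 * v (xCoord (p • T)) := by
        have h0 : 0 < v (xCoord T) ^ (p ^ 2 - 1) := pow_pos (zero_lt_one.trans hx) _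
        rw [← mul_le_mul_iff_left₀ h0, ← pow_succ', Nat.sub_add_cancel (by omega), ← e]
        refine (mul_le_mul_right b _).trans (le_of_eq ?_)
        rw [mul_left_comm, mul_assoc]
      have b₃ : v p ^ 2 * v (xCoord (p • T)) ≤ 1 := by
        rw [← hpQ]
        refine mul_le_mul_right (le_self_pow₀ hxQ.le ?_) _
        have := h.prime.ne_zero
        exact mul_ne_zero (by omega) (pow_ne_zero _ this)
      exact absurd (b₂.trans b₃) (not_le.mpr hx)
    have e₁ : v ((W.ΨSq p).eval (xCoord T)) = 1 := by
      rw [valuation_ΨSq_eval h.prime, ← h.prod_valuation_xCoord]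
      congr 1
      refine Finset.prod_congr rfl fun S hS => ?_
      exact v.map_sub_eq_of_lt_right (hlt.trans_eq (hE R hR S hS))
    rw [e₁, mul_one] at e
    rw [← hpQ, e, ← pow_mul]
    congr 2
    ring

/-- The `p ^ 2` roots of `Φ p - x(Q) ΨSq p` have valuations with product `v(x(Q))`, because its
constant term has that valuation. The smallest root has the required bound. -/
lemma exists_nsmul_eq (h : W.IsSupersingularAt v p) {Q : W.toAffine.Point} (hQ : Q ≠ 0)
    (hx : 1 < v (xCoord Q)) : ∃ T, p • T = Q ∧ v (xCoord T) ^ p ^ 2 ≤ v (xCoord Q) := by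
  obtain ⟨hm, hd⟩ := monic_Φ_sub W h.prime.ne_zero (xCoord Q)
  set f := W.Φ p - C (xCoord Q) * W.ΨSq p with hf
  have hcard : f.roots.card = p ^ 2 := by
    rw [← hd, (IsAlgClosed.splits f).natDegree_eq_card_roots]
  have hf0 : v (f.eval 0) = v (xCoord Q) := by
    have e : v (xCoord Q * (W.ΨSq p).eval 0) = v (xCoord Q) := by
      rw [map_mul, ← coeff_zero_eq_eval_zero, h.ΨSq_zero, mul_one]
    rw [hf, eval_sub, eval_mul, eval_C, ← e]
    refine v.map_sub_eq_of_lt_right ?_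
    rw [e]
    exact (valuation_eval_le_one v h.Φ_le (by simp)).trans_lt hx
  have hne : f.roots.toFinset.Nonempty := by
    rw [Finset.nonempty_iff_ne_empty, Ne, Multiset.toFinset_eq_empty, ← Multiset.card_eq_zero,
      hcard]
    exact pow_ne_zero _ h.prime.ne_zero
  obtain ⟨a, ha, hmin⟩ := Finset.exists_min_image _ v hne
  obtain ⟨T, hT, rfl⟩ := exists_xCoord_eq W a
  have hle : v (xCoord T) ^ p ^ 2 ≤ v (xCoord Q) := by
    rw [← hf0, valuation_eval_eq_prod, hm.leadingCoeff, map_one, one_mul, ← hcard,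
      ← Multiset.card_map (fun r => v (0 - r))]
    refine Multiset.pow_card_le_prod fun z hz => ?_
    obtain ⟨r, hr, rfl⟩ := Multiset.mem_map.mp hz
    rw [zero_sub, v.map_neg]
    exact hmin r (Multiset.mem_toFinset.mpr hr)
  have hroot : f.eval (xCoord T) = 0 := (mem_roots'.mp (Multiset.mem_toFinset.mp ha)).2
  rcases nsmul_eq_or_eq_neg_of_root hT hQ hroot with h' | h'
  · exact ⟨T, h', hle⟩
  · exact ⟨-T, by rw [smul_neg, h', neg_neg], by rwa [xCoord_neg]⟩

/-- Iterated division by `p`, each time choosing the point farthest from the origin. -/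
lemma exists_addOrderOf_eq (h : W.IsSupersingularAt v p) {R : W.toAffine.Point}
    (hR : R ∈ nonzeroTorsion W p) (n : ℕ) : ∃ T : W.toAffine.Point, addOrderOf T = p ^ (n + 1) ∧
      v (xCoord T) ^ ((p ^ 2 - 1) * p ^ (2 * n)) ≤ v (xCoord R) ^ (p ^ 2 - 1) := by
  induction n with
  | zero => exact ⟨R, by rw [h.addOrderOf_of_mem hR, zero_add, pow_one], by simp⟩
  | succ n ih =>
    obtain ⟨Q, hQ, hle⟩ := ih
    have hQ0 : Q ≠ 0 := by
      rintro rfl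
      rw [addOrderOf_zero] at hQ
      exact absurd hQ (Nat.one_lt_pow n.succ_ne_zero h.prime.one_lt).ne
    obtain ⟨T, rfl, hT⟩ := h.exists_nsmul_eq hQ0 (h.one_lt_of_addOrderOf n.succ_ne_zero hQ)
    have := Fact.mk h.prime
    refine ⟨T, addOrderOf_eq_prime_pow (n := n + 1) ?_ ?_, ?_⟩
    · intro h0
      rw [pow_succ', mul_nsmul, ← addOrderOf_dvd_iff_nsmul_eq_zero, hQ,
        Nat.pow_dvd_pow_iff_le_right h.prime.one_lt] at h0
      omega
    · rw [pow_succ', mul_nsmul, ← hQ, addOrderOf_nsmul_eq_zero]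
    · refine le_trans ?_ hle
      rw [show (p ^ 2 - 1) * p ^ (2 * (n + 1)) = p ^ 2 * ((p ^ 2 - 1) * p ^ (2 * n)) by ring,
        pow_mul]
      exact pow_le_pow_left' hT _

/-- Some point of order `p ^ n` is far from the origin. -/
lemma exists_far_point (h : W.IsSupersingularAt v p) (n : ℕ) : ∃ T : W.toAffine.Point,
    addOrderOf T = p ^ (n + 1) ∧ v p ^ 2 * v (xCoord T) ^ ((p ^ 2 - 1) * p ^ (2 * n)) ≤ 1 ∧
    ((∃ R ∈ nonzeroTorsion W p, ∃ Q ∈ nonzeroTorsion W p, v (xCoord R) ≠ v (xCoord Q)) →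
      v p ^ 2 * v (xCoord T) ^ ((p ^ 2 - 1) * p ^ (2 * n)) < 1) := by
  -- Starting from a point `R` of order `p` farthest from the origin, the power `v(x(R))^(p^2 - 1)`
  -- is at most the product over all nonzero `p`-torsion points, and less if the distances differ.
  obtain ⟨R, hR, hmin⟩ := Finset.exists_min_image _ (fun S => v (xCoord S)) h.torsion_nonempty
  obtain ⟨T, hT, hle⟩ := h.exists_addOrderOf_eq hR n
  have p0 := pow_pos h.valuation_pos 2
  refine ⟨T, hT, ?_, ?_⟩
  · rw [← h.prod_valuation_xCoord, mul_le_mul_iff_right₀ p0]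
    refine hle.trans ?_
    rw [← h.card_torsion, ← Finset.prod_const]
    exact Finset.prod_le_prod' hmin
  · rintro ⟨S, hS, Q, hQ, hne⟩
    rw [← h.prod_valuation_xCoord, mul_lt_mul_iff_right₀ p0]
    refine hle.trans_lt ?_
    rw [← h.card_torsion, ← Finset.prod_const]
    have : ∃ S ∈ nonzeroTorsion W p, v (xCoord R) < v (xCoord S) := by
      by_contra! hall
      exact hne (((hall S hS).antisymm (hmin S hS)).trans ((hall Q hQ).antisymm (hmin Q hQ)).symm)
    exact Finset.prod_lt_prod (fun _ _ => zero_lt_one.trans (h.one_lt_of_mem hR)) hmin this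

/-- If `x` is at least as large as every root, each factor is at most `v x`. Otherwise `p - 1` roots
are at least as large as `x` and give factors at most `v(x(S))`. The other `p ^ 2 - p` factors are
at most `v x * v(x(S))`, since both terms exceed `1`, and `prod_valuation_xCoord` removes the roots.
-/
lemma valuation_nsmul_le (h : W.IsSupersingularAt v p) {x : F} (hx : 1 < v x) :
    v ((W.ΨSq p).eval x) ≤ max (v p ^ 2 * v x ^ (p ^ 2 - 1)) (v x ^ (p ^ 2 - p)) := by
  obtain ⟨R, hR, hmax⟩ := Finset.exists_max_image _ (fun S => v (xCoord S)) h.torsion_nonempty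
  rw [valuation_ΨSq_eval h.prime]
  have b : ∀ S : W.toAffine.Point, v (x - xCoord S) ≤ max (v x) (v (xCoord S)) := fun S => v.map_sub _ _
  rcases le_total (v (xCoord R)) (v x) with hRx | hRx
  · refine le_max_of_le_left (mul_le_mul_right ?_ _)
    rw [← h.card_torsion, ← Finset.prod_const]
    exact Finset.prod_le_prod' fun S hS => (b S).trans (max_le le_rfl ((hmax S hS).trans hRx))
  · refine le_max_of_le_right ?_
    obtain ⟨U, hU, cU⟩ := Finset.exists_subset_card_eq (h.sub_one_le_card_filter hR)
    have hUE : U ⊆ nonzeroTorsion W p := hU.trans (Finset.filter_subset _ _)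
    have hc : (nonzeroTorsion W p \ U).card = p ^ 2 - p := by
      rw [Finset.card_sdiff_of_subset hUE, cU, h.card_torsion]
      have := h.prime.pos
      omega
    rw [← mul_one (v x ^ _), ← h.prod_valuation_xCoord, mul_left_comm,
      ← Finset.prod_sdiff hUE, ← Finset.prod_sdiff hUE, ← hc, ← Finset.prod_const, ← mul_assoc (∏ _ ∈ _, _),
      ← Finset.prod_mul_distrib]
    refine mul_le_mul_right (mul_le_mul' (Finset.prod_le_prod' fun S hS => (b S).trans ?_)
      (Finset.prod_le_prod' fun S hS => (b S).trans ?_)) _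
    · have := h.one_lt_of_mem (Finset.mem_sdiff.mp hS).1
      exact max_le (by simpa using mul_le_mul_right this.le (v x))
        (by simpa using mul_le_mul_left hx.le (v (xCoord S)))
    · exact max_le (hRx.trans (Finset.mem_filter.mp (hU hS)).2) le_rfl

/-- Points of order `p ^ n` are not too close to the origin. -/
lemma valuation_pow_lt (h : W.IsSupersingularAt v p) {n : ℕ} {T : W.toAffine.Point}
    (hT : addOrderOf T = p ^ (n + 1)) : v p ^ 2 * v (xCoord T) ^ ((p - 1) * p ^ n) < 1 := by
  have hp2 := h.prime.two_le
  have p0 := pow_pos h.valuation_pos 2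
  induction n generalizing T with
  | zero =>
    rw [zero_add, pow_one] at hT
    have hTE := h.mem_of_addOrderOf hT
    obtain ⟨U, hU, cU⟩ := Finset.exists_subset_card_eq (h.sub_one_le_card_filter hTE)
    have hUE : U ⊆ nonzeroTorsion W p := hU.trans (Finset.filter_subset _ _)
    have hne : (nonzeroTorsion W p \ U).Nonempty := by
      rw [← Finset.card_pos, Finset.card_sdiff_of_subset hUE, cU, h.card_torsion]
      have : p < p ^ 2 := by nlinarith
      omega
    -- At least `p - 1` points are as close as `T`, and the remaining factors of the product exceed
    -- `1`.
    rw [← h.prod_valuation_xCoord, mul_lt_mul_iff_right₀ p0, pow_zero, mul_one, ← cU,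
      ← Finset.prod_const, ← Finset.prod_sdiff hUE]
    have h₁ : ∏ _S ∈ U, v (xCoord T) ≤ ∏ S ∈ U, v (xCoord S) :=
      Finset.prod_le_prod' fun S hS => (Finset.mem_filter.mp (hU hS)).2
    have h₂ : 1 < ∏ S ∈ nonzeroTorsion W p \ U, v (xCoord S) := by
      rw [← Finset.prod_const_one (s := nonzeroTorsion W p \ U)]
      exact Finset.prod_lt_prod_of_nonempty (fun _ _ => zero_lt_one)
        (fun S hS => h.one_lt_of_mem (Finset.mem_sdiff.mp hS).1) hne
    have h₃ : 0 < ∏ S ∈ U, v (xCoord S) :=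
      Finset.prod_pos fun S hS => zero_lt_one.trans (h.one_lt_of_mem (hUE hS))
    exact h₁.trans_lt (by simpa using mul_lt_mul_of_pos_right h₂ h₃)
  | succ n ih =>
    have hQ := h.addOrderOf_nsmul_prime hT
    have hpQ := ih hQ
    have hx := h.one_lt_of_addOrderOf n.succ.succ_ne_zero hT
    have hxQ := h.one_lt_of_addOrderOf n.succ_ne_zero hQ
    have hQ0 : p • T ≠ 0 := by
      intro h0
      rw [h0, addOrderOf_zero] at hQ
      exact absurd hQ (Nat.one_lt_pow n.succ_ne_zero h.prime.one_lt).ne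
    have e := h.valuation_nsmul hQ0 hx
    have hpp : p < p ^ 2 := by nlinarith
    -- The first alternative would give `v(x(T)) ≤ v(p)^2 v(x(pT)) < 1`. The second gives `v(x(T))^p
    -- ≤ v(x(pT))`, which multiplies the exponent by `p`.
    rcases le_max_iff.mp (h.valuation_nsmul_le hx) with b | b
    · exfalso
      have b₂ : v (xCoord T) ≤ v p ^ 2 * v (xCoord (p • T)) := by
        have h0 : 0 < v (xCoord T) ^ (p ^ 2 - 1) := pow_pos (zero_lt_one.trans hx) _
        rw [← mul_le_mul_iff_left₀ h0, ← pow_succ', Nat.sub_add_cancel (by omega), ← e]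
        refine (mul_le_mul_right b _).trans (le_of_eq ?_)
        rw [mul_left_comm, mul_assoc]
      refine absurd ((b₂.trans ?_).trans_lt hpQ) (not_lt.mpr hx.le)
      refine mul_le_mul_right (le_self_pow₀ hxQ.le ?_) _
      exact mul_ne_zero (by omega) (pow_ne_zero _ (by omega))
    · have b₂ : v (xCoord T) ^ p ≤ v (xCoord (p • T)) := by
        have h0 : 0 < v (xCoord T) ^ (p ^ 2 - p) := pow_pos (zero_lt_one.trans hx) _
        rw [← mul_le_mul_iff_left₀ h0, ← pow_add, Nat.add_sub_cancel' hpp.le, ← e]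
        exact mul_le_mul_right b _
      refine lt_of_le_of_lt (mul_le_mul_right ?_ _) hpQ
      rw [show (p - 1) * p ^ (n + 1) = p * ((p - 1) * p ^ n) by ring, pow_mul]
      exact pow_le_pow_left' b₂ _

end IsSupersingularAt

end Supersingular

end WeierstrassCurve

namespace WeierstrassCurve

open Polynomial
open Affine.Point hiding map_zero neg_zero

set_option linter.unusedSectionVars false

/-! ### The Newton polygon criterion for unequal distances. -/

section NewtonPolygon

variable {F : Type*} [Field F] {Γ : Type*} [LinearOrderedCommGroupWithZero Γ] (v : Valuation F Γ)

lemma coeff_prod_X_sub_C_of_card_lt (M : Multiset F) {i : ℕ} (hi : M.card < i) :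
    ((M.map (fun r => X - C r)).prod).coeff i = 0 :=
  coeff_eq_zero_of_natDegree_lt (by rwa [natDegree_multiset_prod_X_sub_C_eq_card])

lemma valuation_coeff_prod_le {ρ : Γ} (M : Multiset F) (hM : ∀ r ∈ M, v r ≤ ρ) {i k : ℕ}
    (hik : i + k = M.card) : v (((M.map (fun r => X - C r)).prod).coeff i) ≤ ρ ^ k := by
  induction M using Multiset.induction generalizing i k with
  | empty =>
    obtain ⟨rfl, rfl⟩ : i = 0 ∧ k = 0 := by simpa using hik
    simp
  | cons r M ih =>
    have hM' : ∀ r ∈ M, v r ≤ ρ := fun s hs => hM s (Multiset.mem_cons_of_mem hs)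
    have hr : v r ≤ ρ := hM r (Multiset.mem_cons_self r M)
    rw [Multiset.card_cons] at hik
    rw [Multiset.map_cons, Multiset.prod_cons, sub_mul, coeff_sub, coeff_C_mul]
    refine v.map_sub_le ?_ ?_
    · cases i with
      | zero => simp
      | succ i => rw [coeff_X_mul]; exact ih hM' (by omega)
    · cases k with
      | zero => rw [coeff_prod_X_sub_C_of_card_lt _ (by omega)]; simp
      | succ k =>
        rw [map_mul, pow_succ']
        exact mul_le_mul' hr (ih hM' (by omega))

/-- This is a vertex of the Newton polygon: in the elementary symmetric function of degree
`M₁.card`, the product of all roots of maximal valuation strictly dominates every other term. -/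
lemma valuation_coeff_prod_eq {ρ : Γ} (M₁ M₂ : Multiset F) (h₁ : ∀ r ∈ M₁, v r = ρ)
    (h₂ : ∀ r ∈ M₂, v r < ρ) (h0 : M₁.card ≠ 0) :
    v ((((M₁ + M₂).map (fun r => X - C r)).prod).coeff M₂.card) = ρ ^ M₁.card := by
  induction M₂ using Multiset.induction with
  | empty =>
    rw [add_zero, Multiset.card_zero, coeff_zero_eq_eval_zero, eval_multiset_prod,
      Multiset.map_map, map_multiset_prod, Multiset.map_map,
      Multiset.map_congr rfl (g := fun _ => ρ) (fun r hr => by simpa using h₁ r hr),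
      Multiset.map_const', Multiset.prod_replicate]
  | cons r M ih =>
    have hM : ∀ r ∈ M, v r < ρ := fun s hs => h₂ s (Multiset.mem_cons_of_mem hs)
    have hr : v r < ρ := h₂ r (Multiset.mem_cons_self r M)
    rw [Multiset.card_cons, Multiset.add_cons, Multiset.map_cons, Multiset.prod_cons, sub_mul,
      coeff_sub, coeff_C_mul, coeff_X_mul, ← ih hM]
    refine v.map_sub_eq_of_lt_left ?_
    rw [ih hM, map_mul]
    obtain ⟨k, hk⟩ := Nat.exists_eq_succ_of_ne_zero h0
    have hρ : 0 < ρ := lt_of_le_of_lt zero_le hr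
    have b := valuation_coeff_prod_le v (ρ := ρ) (M₁ + M) (i := M.card + 1) (k := k)
      (fun s hs => (Multiset.mem_add.mp hs).elim (fun h => (h₁ s h).le) fun h => (hM s h).le)
      (by rw [Multiset.card_add]; omega)
    rw [hk, pow_succ']
    exact mul_lt_mul_of_lt_of_le_of_nonneg_of_pos hr b zero_le (pow_pos hρ k)

end NewtonPolygon

namespace IsSupersingularAt

variable {F : Type*} [Field F] [IsAlgClosed F] [CharZero F] [DecidableEq F]
  {Γ : Type*} [LinearOrderedCommGroupWithZero Γ] {v : Valuation F Γ}
  {W : WeierstrassCurve F} [W.IsElliptic] {p : ℕ}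

/-- The points of order `p` are not all equally far from the origin if and only if the Newton
polygon of the division polynomial has a vertex at the relevant coefficient. -/
lemma exists_ne_iff_of_roots (h : W.IsSupersingularAt v p) {f : F[X]} {t i k : ℕ} (ht : t ≠ 0)
    (hf : t • f.roots = (nonzeroTorsion W p).val.map xCoord) (hc : v f.leadingCoeff ^ t = v p ^ 2)
    (hi : t * i = p ^ 2 - p) (hk : t * k = p - 1) :
    (∃ R ∈ nonzeroTorsion W p, ∃ Q ∈ nonzeroTorsion W p, v (xCoord R) ≠ v (xCoord Q)) ↔
      v p ^ (2 * p) < v (f.coeff i) ^ (t * (p + 1)) := by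
  have hp2 := h.prime.two_le
  have hpp : p ≤ p ^ 2 := by nlinarith
  have p0 := h.valuation_pos
  have hmem : ∀ r ∈ f.roots, ∃ S ∈ nonzeroTorsion W p, xCoord S = r := by
    intro r hr
    have : r ∈ t • f.roots := (Multiset.mem_nsmul_of_ne_zero ht).mpr hr
    rw [hf] at this
    simpa using this
  have hcard : i + k = f.roots.card := by
    have := congrArg Multiset.card hf
    rw [Multiset.card_nsmul, Multiset.card_map, Finset.card_val, h.card_torsion] at this
    refine Nat.eq_of_mul_eq_mul_left (Nat.pos_of_ne_zero ht) ?_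
    rw [this, mul_add, hi, hk]
    omega
  have hfe : v (f.coeff i) = v f.leadingCoeff *
      v (((f.roots.map (fun r => X - C r)).prod).coeff i) := by
    conv_lhs => rw [(IsAlgClosed.splits f).eq_prod_roots, coeff_C_mul, map_mul]
  -- If all roots have valuation `ρ`, then `v(p)^2 ρ^(p^2 - 1) = 1`, and this identity gives exactly
  -- the threshold `v(p)^(2p)`. If `ρ` is the maximum of unequal valuations, the last factor exceeds
  -- `1`.
  have hpow : ∀ ρ : Γ, (v f.leadingCoeff * ρ ^ k) ^ (t * (p + 1)) =
      v p ^ (2 * p) * (v p ^ 2 * ρ ^ (p ^ 2 - 1)) := by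
    intro ρ
    have e : k * (t * (p + 1)) = p ^ 2 - 1 := by
      rw [show k * (t * (p + 1)) = (t * k) * (p + 1) by ring, hk]
      have := Nat.sq_sub_sq p 1
      rw [one_pow] at this
      rw [this, mul_comm]
    rw [mul_pow, ← pow_mul, e, pow_mul, hc, ← mul_assoc, ← pow_mul, ← pow_add]
    ring_nf
  obtain ⟨R, hR, hmax⟩ := Finset.exists_max_image _ (fun S => v (xCoord S)) h.torsion_nonempty
  constructor
  · rintro ⟨S, hS, Q, hQ, hne⟩
    have hex : ∃ S ∈ nonzeroTorsion W p, v (xCoord S) < v (xCoord R) := by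
      by_contra! hall
      exact hne (((hmax S hS).antisymm (hall S hS)).trans ((hmax Q hQ).antisymm (hall Q hQ)).symm)
    obtain ⟨j, hj, e⟩ := h.card_filter (h.one_lt_of_mem hR)
    have hpos : 0 < ((nonzeroTorsion W p).filter (fun T => v (xCoord R) ≤ v (xCoord T))).card :=
      Finset.card_pos.mpr ⟨R, Finset.mem_filter.mpr ⟨hR, le_rfl⟩⟩
    have hlt : ((nonzeroTorsion W p).filter (fun T => v (xCoord R) ≤ v (xCoord T))).card <
        p ^ 2 - 1 := by
      rw [← h.card_torsion]
      obtain ⟨S, hS, hSR⟩ := hex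
      refine Finset.card_lt_card (Finset.filter_ssubset.mpr ⟨S, hS, not_le.mpr hSR⟩)
    -- The subgroup of closest points is nontrivial and proper, so it has order `p`.
    have hj1 : j = 1 := by
      interval_cases j
      · rw [pow_zero] at e; omega
      · rfl
      · omega
    subst hj1
    rw [pow_one] at e
    set M₁ := f.roots.filter (fun r => v (xCoord R) ≤ v r) with hM₁
    set M₂ := f.roots.filter (fun r => ¬ v (xCoord R) ≤ v r) with hM₂
    have hM : M₁ + M₂ = f.roots := Multiset.filter_add_not _ _
    have c₁ : M₁.card = k := by
      refine Nat.eq_of_mul_eq_mul_left (Nat.pos_of_ne_zero ht) ?_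
      rw [← Multiset.card_nsmul, hM₁, ← Multiset.filter_nsmul, hf, Multiset.filter_map,
        Multiset.card_map, hk]
      change ((nonzeroTorsion W p).filter (fun T => v (xCoord R) ≤ v (xCoord T))).card = _
      omega
    have c₂ : M₂.card = i := by
      have := congrArg Multiset.card hM
      rw [Multiset.card_add] at this
      omega
    have hk0 : k ≠ 0 := by
      rintro rfl
      rw [mul_zero] at hk
      omega
    have := valuation_coeff_prod_eq v (ρ := v (xCoord R)) M₁ M₂ (fun r hr => ?_) (fun r hr => ?_)
      (by rwa [c₁])
    · rw [c₂, hM, c₁] at this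
      rw [hfe, this, hpow]
      refine lt_mul_of_one_lt_right (pow_pos p0 _) ?_
      rw [← h.prod_valuation_xCoord, ← h.card_torsion, ← Finset.prod_const]
      refine mul_lt_mul_of_pos_left ?_ (pow_pos p0 2)
      exact Finset.prod_lt_prod (fun S hS => zero_lt_one.trans (h.one_lt_of_mem hS)) hmax hex
    · obtain ⟨hr₁, hr₂⟩ := Multiset.mem_filter.mp hr
      obtain ⟨S, hS, rfl⟩ := hmem r hr₁
      exact (hmax S hS).antisymm hr₂
    · exact not_le.mp (Multiset.mem_filter.mp hr).2
  · intro hlt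
    by_contra! hall
    refine absurd hlt (not_lt.mpr ?_)
    have b := valuation_coeff_prod_le v (ρ := v (xCoord R)) f.roots (fun r hr => by
      obtain ⟨S, hS, rfl⟩ := hmem r hr
      exact hmax S hS) hcard
    calc v (f.coeff i) ^ (t * (p + 1)) ≤ (v f.leadingCoeff * v (xCoord R) ^ k) ^ (t * (p + 1)) := by
          rw [hfe]
          exact pow_le_pow_left' (mul_le_mul_right b _) _
      _ = v p ^ (2 * p) := by
          rw [hpow, ← h.card_torsion, ← Finset.prod_const,
            Finset.prod_congr rfl fun S hS => hall R hR S hS, h.prod_valuation_xCoord, mul_one]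

/-- Here `t = 2`: `preΨ' p` is a square root of `ΨSq p`, with one root for each pair `P, -P`. -/
lemma exists_ne_iff_of_odd (h : W.IsSupersingularAt v p) (hp : p ≠ 2) :
    (∃ R ∈ nonzeroTorsion W p, ∃ Q ∈ nonzeroTorsion W p, v (xCoord R) ≠ v (xCoord Q)) ↔
      v p ^ (2 * p) < v ((W.preΨ' p).coeff ((p ^ 2 - p) / 2)) ^ (2 * (p + 1)) := by
  have hodd := h.prime.odd_of_ne_two hp
  have hp0 : ((p : ℕ) : F) ≠ 0 := by exact_mod_cast h.prime.ne_zero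
  have e : W.ΨSq p = W.preΨ' p ^ 2 := by
    rw [ΨSq_ofNat, if_neg (Nat.not_even_iff_odd.mpr hodd), mul_one]
  refine h.exists_ne_iff_of_roots (k := (p - 1) / 2) two_ne_zero ?_ ?_ ?_ ?_
  · rw [← roots_pow, ← e, ΨSq_roots h.prime]
  · rw [leadingCoeff_preΨ' _ hp0, if_neg (Nat.not_even_iff_odd.mpr hodd)]
  · refine Nat.mul_div_cancel' (even_iff_two_dvd.mp ?_)
    rw [Nat.even_sub (by nlinarith [h.prime.two_le]), Nat.even_pow' two_ne_zero]
  · exact Nat.mul_div_cancel' (even_iff_two_dvd.mp (hodd.tsub_odd odd_one))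

/-- Here `t = 1`: points of order two are their own negatives, and the coefficient at the vertex is
`b₂`. -/
lemma exists_ne_iff_of_two (h : W.IsSupersingularAt v 2) :
    (∃ R ∈ nonzeroTorsion W 2, ∃ Q ∈ nonzeroTorsion W 2, v (xCoord R) ≠ v (xCoord Q)) ↔
      v (2 : ℕ) ^ 4 < v (W.a₁ ^ 2 + 4 * W.a₂) ^ 3 := by
  have e : W.ΨSq (2 : ℕ) = W.Ψ₂Sq := by
    exact_mod_cast W.ΨSq_two
  have := h.exists_ne_iff_of_roots (f := W.Ψ₂Sq) (t := 1) (i := 2) (k := 1) one_ne_zero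
    (by rw [one_nsmul, ← ΨSq_roots h.prime, e])
    (by
      rw [W.leadingCoeff_Ψ₂Sq (by norm_num), pow_one, ← map_pow]
      congr 1
      norm_num) rfl rfl
  rwa [show W.Ψ₂Sq.coeff 2 = W.b₂ by simp [WeierstrassCurve.Ψ₂Sq],
    WeierstrassCurve.b₂] at this

end IsSupersingularAt

end WeierstrassCurve

namespace WeierstrassCurve

open Polynomial
open Affine.Point hiding map_zero neg_zero

set_option linter.unusedSectionVars false

/-! ### The isomorphism on points induced by a change of variables. -/

section VariableChangePoints

variable {F : Type*} [Field F] {W : WeierstrassCurve F} (C : VariableChange F)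

lemma equation_variableChange_iff (x y : F) : (C • W).toAffine.Equation x y ↔
    W.toAffine.Equation (C.u ^ 2 * x + C.r) (C.u ^ 3 * y + C.u ^ 2 * C.s * x + C.t) := by
  have hu : (C.u : F) ≠ 0 := C.u.ne_zero
  rw [Affine.equation_iff, Affine.equation_iff]
  simp only [variableChange_a₁, variableChange_a₂, variableChange_a₃, variableChange_a₄,
    variableChange_a₆, Units.val_inv_eq_inv_val]
  field_simp
  constructor <;> intro h <;> linear_combination h

lemma negY_variableChange (x y : F) :
    W.toAffine.negY (C.u ^ 2 * x + C.r) (C.u ^ 3 * y + C.u ^ 2 * C.s * x + C.t) =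
      C.u ^ 3 * (C • W).toAffine.negY x y + C.u ^ 2 * C.s * x + C.t := by
  have hu : (C.u : F) ≠ 0 := C.u.ne_zero
  simp only [Affine.negY, variableChange_a₁, variableChange_a₃, Units.val_inv_eq_inv_val]
  field_simp
  ring

variable [DecidableEq F] [W.IsElliptic]

/-- The isomorphism of Weierstrass curves given by a change of variables, on points. -/
def ofVariableChangeFun : (C • W).toAffine.Point → W.toAffine.Point
  | .zero => 0
  | .some x y h => .some (C.u ^ 2 * x + C.r) (C.u ^ 3 * y + C.u ^ 2 * C.s * x + C.t)
      (Affine.equation_iff_nonsingular.mp ((equation_variableChange_iff C x y).mp h.1))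

lemma slope_variableChange {x₁ x₂ y₁ y₂ : F} (h₁ : (C • W).toAffine.Equation x₁ y₁)
    (h₂ : (C • W).toAffine.Equation x₂ y₂) (h : ¬(x₁ = x₂ ∧ y₁ = (C • W).toAffine.negY x₂ y₂)) :
    W.toAffine.slope (C.u ^ 2 * x₁ + C.r) (C.u ^ 2 * x₂ + C.r)
      (C.u ^ 3 * y₁ + C.u ^ 2 * C.s * x₁ + C.t) (C.u ^ 3 * y₂ + C.u ^ 2 * C.s * x₂ + C.t) =
      C.u * (C • W).toAffine.slope x₁ x₂ y₁ y₂ + C.s := by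
  have hu : (C.u : F) ≠ 0 := C.u.ne_zero
  by_cases hx : x₁ = x₂
  · subst hx
    have hy : y₁ ≠ (C • W).toAffine.negY x₁ y₂ := fun h' => h ⟨rfl, h'⟩
    have hy' : y₁ = y₂ := Affine.Y_eq_of_Y_ne h₁ h₂ rfl hy
    subst hy'
    rw [Affine.slope_of_Y_ne rfl hy, Affine.slope_of_Y_ne rfl, negY_variableChange]
    · have d : y₁ - (C • W).toAffine.negY x₁ y₁ ≠ 0 := sub_ne_zero.mpr hy
      have e : C.u ^ 3 * y₁ + C.u ^ 2 * C.s * x₁ + C.t -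
          (C.u ^ 3 * (C • W).toAffine.negY x₁ y₁ + C.u ^ 2 * C.s * x₁ + C.t) =
          C.u ^ 3 * (y₁ - (C • W).toAffine.negY x₁ y₁) := by ring
      rw [e, div_eq_iff (mul_ne_zero (pow_ne_zero 3 hu) d), add_mul, ← mul_assoc,
        mul_right_comm (C.u : F), mul_assoc _ _ (y₁ - _), div_mul_cancel₀ _ d]
      simp only [Affine.negY, variableChange_a₁, variableChange_a₂, variableChange_a₃,
        variableChange_a₄, Units.val_inv_eq_inv_val]
      field_simp
      ring
    · rw [negY_variableChange]
      intro h'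
      exact hy (mul_left_cancel₀ (pow_ne_zero 3 hu) (by linear_combination h'))
  · have hX : C.u ^ 2 * x₁ + C.r ≠ C.u ^ 2 * x₂ + C.r := fun h' =>
      hx (mul_left_cancel₀ (pow_ne_zero 2 hu) (by linear_combination h'))
    rw [Affine.slope_of_X_ne hx, Affine.slope_of_X_ne hX]
    have d : x₁ - x₂ ≠ 0 := sub_ne_zero.mpr hx
    have e : C.u ^ 2 * x₁ + C.r - (C.u ^ 2 * x₂ + C.r) = C.u ^ 2 * (x₁ - x₂) := by ring
    rw [e]
    field_simp
    ring

lemma addX_variableChange {x₁ x₂ y₁ y₂ : F} (h₁ : (C • W).toAffine.Equation x₁ y₁)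
    (h₂ : (C • W).toAffine.Equation x₂ y₂) (h : ¬(x₁ = x₂ ∧ y₁ = (C • W).toAffine.negY x₂ y₂)) :
    W.toAffine.addX (C.u ^ 2 * x₁ + C.r) (C.u ^ 2 * x₂ + C.r)
      (W.toAffine.slope (C.u ^ 2 * x₁ + C.r) (C.u ^ 2 * x₂ + C.r)
        (C.u ^ 3 * y₁ + C.u ^ 2 * C.s * x₁ + C.t) (C.u ^ 3 * y₂ + C.u ^ 2 * C.s * x₂ + C.t)) =
      C.u ^ 2 * (C • W).toAffine.addX x₁ x₂ ((C • W).toAffine.slope x₁ x₂ y₁ y₂) + C.r := by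
  have hu : (C.u : F) ≠ 0 := C.u.ne_zero
  rw [Affine.addX, Affine.addX, slope_variableChange C h₁ h₂ h]
  simp only [variableChange_a₁, variableChange_a₂, Units.val_inv_eq_inv_val]
  field_simp
  ring

/-- The isomorphism of Weierstrass curves given by a change of variables, as a homomorphism. -/
def ofVariableChange : (C • W).toAffine.Point →+ W.toAffine.Point where
  toFun := ofVariableChangeFun C
  map_zero' := rfl
  map_add' := by
    rintro (_ | ⟨x₁, y₁, h₁⟩) (_ | ⟨x₂, y₂, h₂⟩)
    · rfl
    · rw [← Affine.Point.zero_def, zero_add]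
      exact (zero_add _).symm
    · rw [← Affine.Point.zero_def, add_zero]
      exact (add_zero _).symm
    · have hu : (C.u : F) ≠ 0 := C.u.ne_zero
      by_cases h : x₁ = x₂ ∧ y₁ = (C • W).toAffine.negY x₂ y₂
      · rw [add_of_Y_eq h.1 h.2]
        refine (add_of_Y_eq (by rw [h.1]) ?_).symm
        rw [negY_variableChange, ← h.2, h.1]
      · have h' : ¬(C.u ^ 2 * x₁ + C.r = C.u ^ 2 * x₂ + C.r ∧
            C.u ^ 3 * y₁ + C.u ^ 2 * C.s * x₁ + C.t =
              W.toAffine.negY (C.u ^ 2 * x₂ + C.r) (C.u ^ 3 * y₂ + C.u ^ 2 * C.s * x₂ + C.t)) := by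
          rintro ⟨hX, hY⟩
          have hx : x₁ = x₂ := mul_left_cancel₀ (pow_ne_zero 2 hu) (by linear_combination hX)
          refine h ⟨hx, mul_left_cancel₀ (pow_ne_zero 3 hu) ?_⟩
          rw [negY_variableChange, hx] at hY
          linear_combination hY
        rw [add_some h]
        refine Eq.trans ?_ (add_some h').symm
        have hX := addX_variableChange C h₁.1 h₂.1 h
        simp only [ofVariableChangeFun]
        congr 1
        · exact hX.symm
        · rw [Affine.addY, Affine.addY, ← negY_variableChange, hX]
          congr 1
          rw [Affine.negAddY, Affine.negAddY, hX, slope_variableChange C h₁.1 h₂.1 h]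
          ring

lemma ofVariableChange_some {x y : F} (h : (C • W).toAffine.Nonsingular x y) :
    ofVariableChange C (.some x y h) =
      .some (C.u ^ 2 * x + C.r) (C.u ^ 3 * y + C.u ^ 2 * C.s * x + C.t)
        (Affine.equation_iff_nonsingular.mp ((equation_variableChange_iff C x y).mp h.1)) := rfl

lemma ofVariableChange_injective :
    Function.Injective (ofVariableChange C : (C • W).toAffine.Point →+ W.toAffine.Point) := by
  rw [injective_iff_map_eq_zero]
  rintro (_ | ⟨x, y, h⟩) h'
  · rfl
  · exact absurd h' (some_ne_zero _)

lemma ofVariableChange_surjective :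
    Function.Surjective (ofVariableChange C : (C • W).toAffine.Point →+ W.toAffine.Point) := by
  have hu : (C.u : F) ≠ 0 := C.u.ne_zero
  rintro (_ | ⟨X, Y, h⟩)
  · exact ⟨0, rfl⟩
  · obtain ⟨x, rfl⟩ : ∃ x, X = C.u ^ 2 * x + C.r := ⟨(X - C.r) / C.u ^ 2, by field_simp; ring⟩
    obtain ⟨y, rfl⟩ : ∃ y, Y = C.u ^ 3 * y + C.u ^ 2 * C.s * x + C.t :=
      ⟨(Y - C.u ^ 2 * C.s * x - C.t) / C.u ^ 3, by field_simp; ring⟩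
    exact ⟨.some x y (Affine.equation_iff_nonsingular.mp
      ((equation_variableChange_iff C x y).mpr h.1)), rfl⟩

end VariableChangePoints

/-! ### The formal parameter and the x-coordinate. -/

section FormalParameter

open SupersingularTorsion

variable {F : Type*} [Field F] {W : WeierstrassCurve F}

/-- For `v(x) > 1` the terms `y ^ 2` and `x ^ 3` dominate the two sides of the equation, so `v(y)^2
= v(x)^3`. -/
lemma valuation_formalParam {Γ : Type*} [LinearOrderedCommGroupWithZero Γ] {v : Valuation F Γ}
    (hW : W.IsIntegralAt v) {Q : W.toAffine.Point} (hQ : Q ≠ 0) (hx : 1 < v (xCoord Q)) :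
    v (formalParam Q) ^ 2 * v (xCoord Q) = 1 := by
  rcases Q with _ | ⟨x, y, h⟩
  · exact absurd rfl hQ
  rw [xCoord_some] at hx ⊢
  have e := (Affine.equation_iff _ _).mp h.1
  have x0 : 0 < v x := zero_lt_one.trans hx
  have x₁₂ : v x < v x ^ 2 := lt_self_pow₀ hx one_lt_two
  have x₂₃ : v x ^ 2 < v x ^ 3 := pow_lt_pow_right₀ hx (by norm_num)
  have hr : v (x ^ 3 + W.a₂ * x ^ 2 + W.a₄ * x + W.a₆) = v x ^ 3 := by
    rw [add_assoc, add_assoc, ← map_pow]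
    refine v.map_add_eq_of_lt_left ?_
    rw [map_pow]
    refine v.map_add_lt ?_ (v.map_add_lt ?_ (hW.a₆.trans_lt (one_lt_pow₀ hx three_ne_zero)))
    · rw [map_mul, map_pow]
      exact (mul_le_of_le_one_left' hW.a₂).trans_lt x₂₃
    · rw [map_mul]
      exact (mul_le_of_le_one_left' hW.a₄).trans_lt (x₁₂.trans x₂₃)
  have hxy : v x < v y := by
    by_contra! hle
    refine absurd hr (ne_of_lt ?_)
    rw [← e]
    refine lt_of_le_of_lt (v.map_add_le (v.map_add_le ?_ ?_) ?_) x₂₃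
    · rw [map_pow]
      exact pow_le_pow_left' hle 2
    · rw [map_mul, map_mul, sq]
      exact mul_le_mul' (mul_le_of_le_one_left' hW.a₁) hle
    · rw [map_mul]
      exact (mul_le_of_le_one_left' hW.a₃).trans (hle.trans x₁₂.le)
  have y0 : 0 < v y := x0.trans hxy
  have hl : v (y ^ 2 + W.a₁ * x * y + W.a₃ * y) = v y ^ 2 := by
    rw [add_assoc, ← map_pow]
    refine v.map_add_eq_of_lt_left ?_
    rw [map_pow]
    refine v.map_add_lt ?_ ?_
    · rw [map_mul, map_mul, sq]
      exact mul_lt_mul_of_pos_right ((mul_le_of_le_one_left' hW.a₁).trans_lt hxy) y0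
    · rw [map_mul]
      exact (mul_le_of_le_one_left' hW.a₃).trans_lt (lt_self_pow₀ (hx.trans hxy) one_lt_two)
  rw [e, hr] at hl
  change v (-x / y) ^ 2 * v x = 1
  rw [map_div₀, v.map_neg, div_pow, ← hl, div_mul_eq_mul_div, ← pow_succ,
    div_self (pow_ne_zero 3 x0.ne')]

lemma inKernelOfReduction_iff {A : ValuationSubring F} {Q : W.toAffine.Point} (hQ : Q ≠ 0) :
    InKernelOfReduction A Q ↔ 1 < A.valuation (xCoord Q) := by
  rcases Q with _ | ⟨x, y, h⟩
  · exact absurd rfl hQ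
  · rw [xCoord_some, ← not_le, A.valuation_le_one_iff]
    rfl

end FormalParameter

end WeierstrassCurve

namespace SupersingularTorsion

open WeierstrassCurve Polynomial
open Affine.Point hiding map_zero neg_zero

/-! ### Comparison of a valuation with an extension of it. -/

section Extension

variable {K L : Type*} [Field K] [Field L] [Algebra K L] {Γ : Type*}
  [LinearOrderedCommGroupWithZero Γ] {w : Valuation K Γ} {A : ValuationSubring L}

lemma isEquiv_comap_valuation (hA : A.comap (algebraMap K L) = w.valuationSubring) :
    (A.valuation.comap (algebraMap K L)).IsEquiv w := by
  rw [Valuation.isEquiv_iff_val_le_one]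
  intro x
  rw [Valuation.comap_apply, A.valuation_le_one_iff, ← ValuationSubring.mem_comap, hA]
  rfl

lemma valuation_algebraMap_lt_iff (hA : A.comap (algebraMap K L) = w.valuationSubring) {a b : K} :
    A.valuation (algebraMap K L a) < A.valuation (algebraMap K L b) ↔ w a < w b :=
  (isEquiv_comap_valuation hA).lt_iff_lt

lemma valuation_algebraMap_le_iff (hA : A.comap (algebraMap K L) = w.valuationSubring) {a b : K} :
    A.valuation (algebraMap K L a) ≤ A.valuation (algebraMap K L b) ↔ w a ≤ w b :=
  isEquiv_comap_valuation hA _ _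

lemma valuation_algebraMap_lt_one_iff (hA : A.comap (algebraMap K L) = w.valuationSubring) {a : K} :
    A.valuation (algebraMap K L a) < 1 ↔ w a < 1 := by
  rw [← map_one A.valuation, ← map_one (algebraMap K L), valuation_algebraMap_lt_iff hA, map_one]

lemma valuation_algebraMap_le_one_iff (hA : A.comap (algebraMap K L) = w.valuationSubring) {a : K} :
    A.valuation (algebraMap K L a) ≤ 1 ↔ w a ≤ 1 := by
  rw [← map_one A.valuation, ← map_one (algebraMap K L), valuation_algebraMap_le_iff hA, map_one]

end Extension

/-! ### Supersingular reduction in terms of the division polynomial. -/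

section Reduction

/-- Over an algebraic closure every `x` is the x-coordinate of a point, so a root of `ΨSq p` would
yield a nonzero point killed by `p`. A polynomial without roots is a nonzero constant. -/
lemma ΨSq_map_ne_zero_of_isSupersingular {k : Type*} [Field k] {p : ℕ} {W : WeierstrassCurve k}
    [W.IsElliptic] (h : IsSupersingular p W) : (W.ΨSq p).coeff 0 ≠ 0 ∧
      ∀ i, i ≠ 0 → (W.ΨSq p).coeff i = 0 := by
  classical
  set φ := algebraMap k (AlgebraicClosure k)
  have hφ : Function.Injective φ := φ.injective
  have : (W.baseChange (AlgebraicClosure k)).IsElliptic :=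
    inferInstanceAs (W.map φ).IsElliptic
  have e : (W.baseChange (AlgebraicClosure k)).ΨSq p = (W.ΨSq p).map φ := W.map_ΨSq φ p
  have hroot : ∀ x, ((W.ΨSq p).map φ).eval x ≠ 0 := by
    intro x hx
    obtain ⟨P, hP, rfl⟩ := exists_xCoord_eq (W.baseChange (AlgebraicClosure k)) x
    rw [← e] at hx
    exact hP (h P (by convert (nsmul_eq_zero_iff hP p).mpr hx))
  have hdeg : ((W.ΨSq p).map φ).degree = 0 := by
    by_contra hd
    obtain ⟨x, hx⟩ := IsAlgClosed.exists_root _ hd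
    exact hroot x hx
  rw [degree_map] at hdeg
  refine ⟨?_, fun i hi => coeff_eq_zero_of_degree_lt ?_⟩
  · intro h0
    rw [eq_C_of_degree_eq_zero hdeg, h0, C_0, degree_zero] at hdeg
    exact absurd hdeg (by simp)
  · rw [hdeg]
    exact_mod_cast Nat.pos_of_ne_zero hi

variable {K : Type*} [Field K] [NumberField K] {W : WeierstrassCurve K}
  {𝔭 : HeightOneSpectrum (𝓞 K)} {p : ℕ} {L : Type*} [Field L] [Algebra K L]

lemma residue_eq_zero_iff_valuation (r : localRing 𝔭) :
    IsLocalRing.residue (localRing 𝔭) r = 0 ↔ 𝔭.valuation K r < 1 := by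
  have h : IsUnit r ↔ 𝔭.valuation K r = 1 :=
    (Valuation.integer.integers (𝔭.valuation K)).isUnit_iff_valuation_eq_one
  rw [IsLocalRing.residue_eq_zero_iff, IsLocalRing.mem_maximalIdeal, mem_nonunits_iff, h]
  exact (lt_iff_le_and_ne.trans (and_iff_right r.2)).symm

lemma HasSupersingularReduction.isSupersingularAt (hW : HasSupersingularReduction W 𝔭 p)
    (hp : p.Prime) (hp𝔭 : (p : 𝓞 K) ∈ 𝔭.asIdeal) {A : ValuationSubring L}
    (hA : A.comap (algebraMap K L) = localRing 𝔭) :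
    (W.baseChange L).IsSupersingularAt A.valuation p := by
  obtain ⟨hmin, hgood, hss⟩ := hW
  have := hasGoodReduction_iff_isElliptic_reduction (localRing 𝔭) |>.mp hgood
  obtain ⟨h0, hi⟩ := ΨSq_map_ne_zero_of_isSupersingular hss
  set W₀ := W.integralModel (localRing 𝔭)
  have hW₀ : W = W₀.map (algebraMap (localRing 𝔭) K) :=
    (baseChange_integralModel_eq (localRing 𝔭) W).symm
  have hred : W.reduction (localRing 𝔭) = W₀.map (IsLocalRing.residue (localRing 𝔭)) := rfl
  have hle : ∀ r : localRing 𝔭, A.valuation (algebraMap K L (algebraMap (localRing 𝔭) K r)) ≤ 1 :=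
    fun r => (valuation_algebraMap_le_one_iff hA).mpr r.2
  have hlt : ∀ r : localRing 𝔭, A.valuation (algebraMap K L (algebraMap (localRing 𝔭) K r)) < 1 ↔
      IsLocalRing.residue (localRing 𝔭) r = 0 := fun r => by
    rw [residue_eq_zero_iff_valuation, valuation_algebraMap_lt_one_iff hA]
    rfl
  have hΨ : ∀ i, ((W.baseChange L).ΨSq p).coeff i =
      algebraMap K L (algebraMap (localRing 𝔭) K ((W₀.ΨSq p).coeff i)) := fun i => by
    rw [WeierstrassCurve.baseChange, map_ΨSq, hW₀, map_ΨSq, coeff_map, coeff_map]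
  have hΦ : ∀ i, ((W.baseChange L).Φ p).coeff i =
      algebraMap K L (algebraMap (localRing 𝔭) K ((W₀.Φ p).coeff i)) := fun i => by
    rw [WeierstrassCurve.baseChange, map_Φ, hW₀, map_Φ, coeff_map, coeff_map]
  rw [hred, map_ΨSq, coeff_map] at h0
  refine ⟨⟨?_, ?_, ?_, ?_, ?_⟩, hp, ?_, fun i => ?_, ?_, fun i hi0 => ?_⟩
  · change A.valuation (algebraMap K L W.a₁) ≤ 1
    rw [hW₀]
    exact hle _
  · change A.valuation (algebraMap K L W.a₂) ≤ 1
    rw [hW₀]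
    exact hle _
  · change A.valuation (algebraMap K L W.a₃) ≤ 1
    rw [hW₀]
    exact hle _
  · change A.valuation (algebraMap K L W.a₄) ≤ 1
    rw [hW₀]
    exact hle _
  · change A.valuation (algebraMap K L W.a₆) ≤ 1
    rw [hW₀]
    exact hle _
  · rw [← map_natCast (algebraMap K L), valuation_algebraMap_lt_one_iff hA,
      ← map_natCast (algebraMap (𝓞 K) K), HeightOneSpectrum.valuation_lt_one_iff_mem]
    exact hp𝔭
  · rw [hΦ]
    exact hle _
  · rw [hΨ]
    exact (hle _).antisymm (not_lt.mp fun h => h0 ((hlt _).mp h))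
  · rw [hΨ, hlt, ← coeff_map, ← map_ΨSq, ← hred]
    exact hi i hi0

end Reduction

/-! ### Existence of extensions of valuation rings. -/

section Existence

variable {K L : Type*} [Field K] [Field L] [Algebra K L]

/-- Some valuation ring `A` of `L` dominates the image of `B`. If `x` lies in `A` but `x⁻¹` lies in
`B`, then `x⁻¹` is a unit of `A`, hence of `B` by locality, so `x` lies in `B`. -/
lemma exists_valuationSubring_comap_eq (B : ValuationSubring K) :
    ∃ A : ValuationSubring L, A.comap (algebraMap K L) = B := by
  obtain ⟨A, hA, hloc⟩ :=
    (LocalSubring.map (algebraMap K L) B.toLocalSubring).exists_le_valuationSubring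
  have hmem : ∀ {x : K}, x ∈ B → algebraMap K L x ∈ A := fun {x} hx => hA ⟨x, hx, rfl⟩
  refine ⟨A, SetLike.ext fun x => ⟨fun hx => ?_, fun hx => hmem hx⟩⟩
  refine (B.mem_or_inv_mem x).elim id fun hinv => ?_
  by_cases hx0 : x = 0
  · rw [hx0]
    exact B.zero_mem
  have h0 : algebraMap K L x ≠ 0 := (_root_.map_ne_zero _).mpr hx0
  have hu : IsUnit (Subring.inclusion hA ⟨algebraMap K L x⁻¹, ⟨x⁻¹, hinv, rfl⟩⟩) := by
    refine isUnit_iff_exists_inv.mpr ⟨⟨algebraMap K L x, hx⟩, Subtype.ext ?_⟩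
    change algebraMap K L x⁻¹ * algebraMap K L x = 1
    rw [map_inv₀, inv_mul_cancel₀ h0]
  obtain ⟨⟨_, z, hz, rfl⟩, hxz⟩ := isUnit_iff_exists_inv.mp (hloc.1 _ hu)
  have e : algebraMap K L x⁻¹ * algebraMap K L z = 1 := congrArg Subtype.val hxz
  have : z = x := by
    rw [← map_mul, ← map_one (algebraMap K L)] at e
    exact ((eq_inv_of_mul_eq_one_right ((algebraMap K L).injective e)).trans (inv_inv x))
  exact this ▸ hz

end Existence

end SupersingularTorsion

namespace SupersingularTorsion

open WeierstrassCurve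
open Affine.Point hiding map_zero neg_zero

/-! ### Bounds for the formal parameter and the canonical subgroup. -/

section FormalParameter

/-- Used with `a = v(p)`, `x = v(x(T))` and `f = v(T̂)`: eliminating `x` leaves an inequality
between squares. The next two lemmas are its variants for `≤` and `=`. -/
lemma lt_pow_of_mul_lt_one {Γ : Type*} [LinearOrderedCommGroupWithZero Γ] {a x f : Γ} {N : ℕ}
    (hf : f ^ 2 * x = 1) (h : a ^ 2 * x ^ N < 1) : a < f ^ N := by
  have f0 : 0 < f := zero_lt_iff.mpr (by rintro rfl; simp at hf)
  refine lt_of_pow_lt_pow_left₀ 2 zero_le ?_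
  have h₁ : 0 < f ^ (2 * N) := pow_pos f0 _
  have := mul_lt_mul_of_pos_right h h₁
  rwa [one_mul, pow_mul, mul_assoc, ← mul_pow, mul_comm x, hf, one_pow, mul_one, ← pow_mul,
    mul_comm 2 N, pow_mul] at this

lemma le_pow_of_mul_le_one {Γ : Type*} [LinearOrderedCommGroupWithZero Γ] {a x f : Γ} {N : ℕ}
    (hf : f ^ 2 * x = 1) (h : a ^ 2 * x ^ N ≤ 1) : a ≤ f ^ N := by
  refine le_of_pow_le_pow_left₀ two_ne_zero zero_le ?_
  have := mul_le_mul_left h (f ^ (2 * N))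
  rwa [one_mul, pow_mul, mul_assoc, ← mul_pow, mul_comm x, hf, one_pow, mul_one, ← pow_mul,
    mul_comm 2 N, pow_mul] at this

lemma eq_pow_of_mul_eq_one {Γ : Type*} [LinearOrderedCommGroupWithZero Γ] {a x f : Γ} {N : ℕ}
    (hf : f ^ 2 * x = 1) (h : a ^ 2 * x ^ N = 1) : a = f ^ N := by
  refine (le_pow_of_mul_le_one hf h.le).antisymm ?_
  refine le_of_pow_le_pow_left₀ two_ne_zero zero_le ?_
  have := mul_le_mul_left h.ge (f ^ (2 * N))
  rwa [one_mul, pow_mul, mul_assoc, ← mul_pow, mul_comm x, hf, one_pow, mul_one, ← pow_mul,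
    mul_comm 2 N, pow_mul] at this

variable {F : Type*} [Field F] [IsAlgClosed F] [CharZero F] {A : ValuationSubring F}
  {W : WeierstrassCurve F} [W.IsElliptic] {p : ℕ}

open scoped Classical in
lemma mem_formalTorsion_iff (h : W.IsSupersingularAt A.valuation p) {Q : W.toAffine.Point} :
    Q ∈ formalTorsion A W p ↔ Q ∈ nonzeroTorsion W p := by
  refine ⟨fun hQ => h.mem_of_addOrderOf hQ.2, fun hQ => ⟨?_, h.addOrderOf_of_mem hQ⟩⟩
  exact (inKernelOfReduction_iff (h.mem_torsion.mp hQ).1).mpr (h.one_lt_of_mem hQ)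

open scoped Classical in
lemma valuation_formalParam_lt_iff (h : W.IsSupersingularAt A.valuation p)
    {R Q : W.toAffine.Point} (hR : R ∈ nonzeroTorsion W p) (hQ : Q ∈ nonzeroTorsion W p) :
    A.valuation (formalParam R) < A.valuation (formalParam Q) ↔
      A.valuation (xCoord Q) < A.valuation (xCoord R) := by
  have eR := valuation_formalParam h.integral (h.mem_torsion.mp hR).1 (h.one_lt_of_mem hR)
  have eQ := valuation_formalParam h.integral (h.mem_torsion.mp hQ).1 (h.one_lt_of_mem hQ)
  rw [← pow_lt_pow_iff_left₀ zero_le zero_le two_ne_zero, eq_inv_of_mul_eq_one_left eR,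
    eq_inv_of_mul_eq_one_left eQ, inv_lt_inv₀ (zero_lt_one.trans (h.one_lt_of_mem hR))
      (zero_lt_one.trans (h.one_lt_of_mem hQ))]

open scoped Classical in
lemma exists_isCanonicalSubgroup_iff (h : W.IsSupersingularAt A.valuation p) :
    (∃ C, IsCanonicalSubgroup A W p C) ↔ ∃ R ∈ nonzeroTorsion W p, ∃ Q ∈ nonzeroTorsion W p,
      A.valuation (xCoord R) ≠ A.valuation (xCoord Q) := by
  constructor
  · rintro ⟨C, R, hR, Q, hQ, hlt, -⟩
    rw [mem_formalTorsion_iff h] at hR hQ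
    exact ⟨R, hR, Q, hQ, ((valuation_formalParam_lt_iff h hR hQ).mp hlt).ne'⟩
  · rintro ⟨R, hR, Q, hQ, hne⟩
    rcases lt_or_gt_of_ne hne with hlt | hlt
    · exact ⟨_, Q, (mem_formalTorsion_iff h).mpr hQ, R, (mem_formalTorsion_iff h).mpr hR,
        (valuation_formalParam_lt_iff h hQ hR).mpr hlt, rfl⟩
    · exact ⟨_, R, (mem_formalTorsion_iff h).mpr hR, Q, (mem_formalTorsion_iff h).mpr hQ,
        (valuation_formalParam_lt_iff h hR hQ).mpr hlt, rfl⟩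

end FormalParameter

/-! ### The invariant `μ` and the threshold `p / (p + 1)`. -/

section Invariant

variable {K : Type*} [Field K] [NumberField K] {W : WeierstrassCurve K}
  {𝔭 : HeightOneSpectrum (𝓞 K)} {p : ℕ}

/-- The logarithm of `v(p)` is negative, so dividing by it turns the multiplicative order into the
additive one. -/
lemma normalizedVal_lt_iff (hp𝔭 : 𝔭.valuation K p < 1) (hp0 : p ≠ 0) {c : K} {a b : ℕ}
    (hb : b ≠ 0) : normalizedVal 𝔭 p c < (((a : ℚ) / b : ℚ) : WithTop ℚ) ↔
      𝔭.valuation K p ^ a < 𝔭.valuation K c ^ b := by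
  have hp0' : 𝔭.valuation K p ≠ 0 := by
    rw [Valuation.ne_zero_iff]
    exact_mod_cast hp0
  rw [normalizedVal]
  split_ifs with hc
  · simp [hc, hb]
  · have hc' : 𝔭.valuation K c ≠ 0 := (Valuation.ne_zero_iff _).mpr hc
    have hlog : WithZero.log (𝔭.valuation K p) < 0 := by
      rwa [← WithZero.log_one, WithZero.log_lt_log hp0' one_ne_zero]
    have hlogQ : ((WithZero.log (𝔭.valuation K p) : ℤ) : ℚ) < 0 := by exact_mod_cast hlog
    have hbQ : (0 : ℚ) < b := by exact_mod_cast Nat.pos_of_ne_zero hb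
    rw [← WithZero.log_lt_log (pow_ne_zero _ hp0') (pow_ne_zero _ hc'), WithZero.log_pow,
      WithZero.log_pow, WithTop.coe_lt_coe, div_lt_iff_of_neg hlogQ, div_mul_eq_mul_div,
      div_lt_iff₀ hbQ, nsmul_eq_mul, nsmul_eq_mul, mul_comm _ (b : ℚ)]
    exact_mod_cast Iff.rfl

lemma mu_lt_iff_of_ne_two (hp𝔭 : 𝔭.valuation K p < 1) (hp0 : p ≠ 0) (hp2 : p ≠ 2) :
    mu W 𝔭 p < (((p : ℚ) / ((p : ℚ) + 1) : ℚ) : WithTop ℚ) ↔ 𝔭.valuation K p ^ (2 * p) <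
      𝔭.valuation K ((W.preΨ' p).coeff ((p ^ 2 - p) / 2)) ^ (2 * (p + 1)) := by
  rw [mu, if_neg hp2, ← normalizedVal_lt_iff hp𝔭 hp0 (by positivity)]
  have : ((p : ℚ) / ((p : ℚ) + 1) : ℚ) = ((2 * p : ℕ) : ℚ) / ((2 * (p + 1) : ℕ) : ℚ) := by
    push_cast
    rw [mul_div_mul_left _ _ two_ne_zero]
  rw [this]

lemma mu_two_lt_iff (hp𝔭 : 𝔭.valuation K (2 : ℕ) < 1) :
    mu W 𝔭 2 < ((((2 : ℕ) : ℚ) / (((2 : ℕ) : ℚ) + 1) : ℚ) : WithTop ℚ) ↔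
      𝔭.valuation K (2 : ℕ) ^ 4 < 𝔭.valuation K (W.a₁ ^ 2 + 4 * W.a₂) ^ 3 := by
  rw [mu, if_pos rfl, ← normalizedVal_lt_iff hp𝔭 two_ne_zero three_ne_zero]
  cases normalizedVal 𝔭 2 (W.a₁ ^ 2 + 4 * W.a₂) with
  | top => simp
  | coe q =>
    rw [WithTop.map_coe, WithTop.coe_lt_coe, WithTop.coe_lt_coe]
    constructor <;> intro h <;> norm_num at h ⊢ <;> linarith

variable [W.IsElliptic]

open scoped Classical in
-- Since `μ` depends only on `K`, this also proves that the choice of the extension `A` is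
-- immaterial.
lemma exists_isCanonicalSubgroup_iff_mu_lt (hW : HasSupersingularReduction W 𝔭 p) (hp : p.Prime)
    (hp𝔭 : (p : 𝓞 K) ∈ 𝔭.asIdeal) {A : ValuationSubring (AlgebraicClosure K)}
    (hA : A.comap (algebraMap K (AlgebraicClosure K)) = localRing 𝔭) :
    (∃ C, IsCanonicalSubgroup A (W.baseChange (AlgebraicClosure K)) p C) ↔
      mu W 𝔭 p < (((p : ℚ) / ((p : ℚ) + 1) : ℚ) : WithTop ℚ) := by
  have : (W.baseChange (AlgebraicClosure K)).IsElliptic :=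
    inferInstanceAs (W.map (algebraMap K (AlgebraicClosure K))).IsElliptic
  have hss := hW.isSupersingularAt hp hp𝔭 hA
  have hp1 : 𝔭.valuation K p < 1 := by
    rw [← valuation_algebraMap_lt_one_iff hA, map_natCast]
    exact hss.lt_one
  rw [exists_isCanonicalSubgroup_iff hss]
  by_cases hp2 : p = 2
  · subst hp2
    rw [hss.exists_ne_iff_of_two, mu_two_lt_iff hp1, ← map_pow, ← map_pow, ← map_pow, ← map_pow,
      ← valuation_algebraMap_lt_iff hA]
    simp only [WeierstrassCurve.baseChange, map_a₁, map_a₂, map_pow, map_add, map_mul, map_natCast,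
      map_ofNat]
  · rw [hss.exists_ne_iff_of_odd hp2, mu_lt_iff_of_ne_two hp1 hp.ne_zero hp2, ← map_pow, ← map_pow,
      ← map_pow, ← map_pow, ← valuation_algebraMap_lt_iff hA, WeierstrassCurve.baseChange,
      map_preΨ', Polynomial.coeff_map]
    simp

lemma hasCanonicalSubgroup_iff_mu_lt (hW : HasSupersingularReduction W 𝔭 p) (hp : p.Prime)
    (hp𝔭 : (p : 𝓞 K) ∈ 𝔭.asIdeal) : HasCanonicalSubgroup W 𝔭 p ↔
      mu W 𝔭 p < (((p : ℚ) / ((p : ℚ) + 1) : ℚ) : WithTop ℚ) := by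
  constructor
  · rintro ⟨A, hA, h⟩
    exact (exists_isCanonicalSubgroup_iff_mu_lt hW hp hp𝔭 hA).mp h
  · intro h
    obtain ⟨A, hA⟩ := exists_valuationSubring_comap_eq (L := AlgebraicClosure K) (localRing 𝔭)
    exact ⟨A, hA, (exists_isCanonicalSubgroup_iff_mu_lt hW hp hp𝔭 hA).mpr h⟩

end Invariant

/-! ### From valuations to ramification indices. -/

section Ramification

lemma valuation_natCast_eq {M : Type*} [Field M] [NumberField M] (𝔓 : HeightOneSpectrum (𝓞 M))
    {p : ℕ} (hp : p.Prime) (hp𝔓 : (p : 𝓞 M) ∈ 𝔓.asIdeal) :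
    𝔓.valuation M p = WithZero.exp (-(𝔓.asIdeal.ramificationIdx ℤ : ℤ)) := by
  have hp0 : (p : 𝓞 M) ≠ 0 := by exact_mod_cast hp.ne_zero
  have hmap : (Ideal.span {(p : ℤ)}).map (algebraMap ℤ (𝓞 M)) = Ideal.span {(p : 𝓞 M)} := by
    rw [Ideal.map_span, Set.image_singleton, map_natCast]
  have hmax : (Ideal.span {(p : ℤ)}).IsMaximal :=
    PrincipalIdealRing.isMaximal_of_irreducible (Nat.prime_iff_prime_int.mp hp).irreducible
  have : 𝔓.asIdeal.LiesOver (Ideal.span {(p : ℤ)}) := by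
    refine ⟨hmax.eq_of_le (Ideal.IsPrime.under ℤ 𝔓.asIdeal).ne_top ?_⟩
    rw [Ideal.under_def, ← Ideal.map_le_iff_le_comap, hmap, Ideal.span_singleton_le_iff_mem]
    exact hp𝔓
  rw [Ideal.IsDedekindDomain.ramificationIdx_eq_multiplicity (Ideal.span {(p : ℤ)}) 𝔓.asIdeal, hmap,
    ← map_natCast (algebraMap (𝓞 M) M), 𝔓.valuation_of_algebraMap,
    𝔓.intValuation_eq_exp_neg_multiplicity hp0]
  rw [hmap]
  simpa using hp0

variable {M : Type*} [Field M] [NumberField M] {𝔓 : HeightOneSpectrum (𝓞 M)} {p : ℕ}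

lemma neg_ramificationIdx_eq (hp : p.Prime) (hp𝔓 : (p : 𝓞 M) ∈ 𝔓.asIdeal) :
    (WithZero.log (𝔓.valuation M p) : ℤ) = -(𝔓.asIdeal.ramificationIdx ℤ : ℤ) := by
  rw [valuation_natCast_eq 𝔓 hp hp𝔓, WithZero.log_exp]

lemma dvd_ramificationIdx (hp : p.Prime) (hp𝔓 : (p : 𝓞 M) ∈ 𝔓.asIdeal) {z : M} {N : ℕ}
    (h : 𝔓.valuation M p = 𝔓.valuation M z ^ N) : N ∣ 𝔓.asIdeal.ramificationIdx ℤ := by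
  have e := congrArg WithZero.log h
  rw [neg_ramificationIdx_eq hp hp𝔓, WithZero.log_pow, nsmul_eq_mul] at e
  exact Int.natCast_dvd_natCast.mp ((dvd_neg.mp ⟨_, e⟩))

/-- Discreteness enters here: `v(z) < 1` means that the logarithm of `v(z)` is at most `-1`. -/
lemma lt_ramificationIdx (hp : p.Prime) (hp𝔓 : (p : 𝓞 M) ∈ 𝔓.asIdeal) {z : M} (hz0 : z ≠ 0)
    (hz : 𝔓.valuation M z < 1) {N : ℕ} (h : 𝔓.valuation M p < 𝔓.valuation M z ^ N) :
    N < 𝔓.asIdeal.ramificationIdx ℤ := by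
  have hz0' : 𝔓.valuation M z ≠ 0 := (Valuation.ne_zero_iff _).mpr hz0
  have hp0 : 𝔓.valuation M p ≠ 0 := by rw [valuation_natCast_eq 𝔓 hp hp𝔓]; exact WithZero.exp_ne_zero
  rw [← WithZero.log_lt_log hz0' one_ne_zero, WithZero.log_one] at hz
  rw [← WithZero.log_lt_log hp0 (pow_ne_zero _ hz0'), neg_ramificationIdx_eq hp hp𝔓,
    WithZero.log_pow, nsmul_eq_mul] at h
  have : (N : ℤ) * WithZero.log (𝔓.valuation M z) ≤ N * (-1) :=
    mul_le_mul_of_nonneg_left (by omega) (Nat.cast_nonneg N)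
  omega

lemma le_ramificationIdx (hp : p.Prime) (hp𝔓 : (p : 𝓞 M) ∈ 𝔓.asIdeal) {z : M} (hz0 : z ≠ 0)
    (hz : 𝔓.valuation M z < 1) {N : ℕ} (h : 𝔓.valuation M p ≤ 𝔓.valuation M z ^ N) :
    N ≤ 𝔓.asIdeal.ramificationIdx ℤ := by
  rcases h.lt_or_eq with h | h
  · exact (lt_ramificationIdx hp hp𝔓 hz0 hz h).le
  · refine Nat.le_of_dvd ?_ (dvd_ramificationIdx hp hp𝔓 h)
    refine lt_ramificationIdx hp hp𝔓 hz0 hz ?_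
    rw [pow_zero, ← map_natCast (algebraMap (𝓞 M) M), 𝔓.valuation_lt_one_iff_mem]
    exact hp𝔓

end Ramification

end SupersingularTorsion

namespace SupersingularTorsion

set_option linter.unusedSectionVars false

open WeierstrassCurve
open Affine.Point hiding map_zero neg_zero

/-! ### Fields containing the formal parameters. -/

section PointTransfer

/-- The division field is generated by coordinates on `E`, whereas the parameter is taken on the
minimal equation; the change of variables can be inverted inside the subfield. -/
lemma formalParam_mem_subfield {F : Type*} [Field F] [DecidableEq F] {W : WeierstrassCurve F}
    [W.IsElliptic] (C : VariableChange F) {S : Subfield F} (hu : (C.u : F) ∈ S) (hr : C.r ∈ S)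
    (hs : C.s ∈ S) (ht : C.t ∈ S) {T : (C • W).toAffine.Point}
    (hT : ∀ X Y h, ofVariableChange C T = Affine.Point.some X Y h → X ∈ S ∧ Y ∈ S) :
    formalParam T ∈ S := by
  rcases T with _ | ⟨x, y, h⟩
  · exact zero_mem S
  obtain ⟨hX, hY⟩ := hT _ _ _ (ofVariableChange_some C h)
  have hu0 : (C.u : F) ≠ 0 := C.u.ne_zero
  have hx : x ∈ S := by
    have e : x = (C.u ^ 2 * x + C.r - C.r) / C.u ^ 2 := by field_simp; ring
    rw [e]
    exact div_mem (sub_mem hX hr) (pow_mem hu 2)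
  have hy : y ∈ S := by
    have e : y = (C.u ^ 3 * y + C.u ^ 2 * C.s * x + C.t - C.u ^ 2 * C.s * x - C.t) /
        C.u ^ 3 := by field_simp; ring
    rw [e]
    exact div_mem (sub_mem (sub_mem hY (mul_mem (mul_mem (pow_mem hu 2) hs) hx)) ht)
      (pow_mem hu 3)
  exact div_mem (neg_mem hx) hy

variable {K : Type*} [Field K] (E : WeierstrassCurve K) [E.IsElliptic]
  (C : VariableChange K)

instance isElliptic_baseChange {L : Type*} [Field L] [Algebra K L] :
    (E.baseChange L).IsElliptic :=
  inferInstanceAs (E.map (algebraMap K L)).IsElliptic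

open scoped Classical in
lemma exists_formalParam_eq_algebraMap [DecidableEq K] (L : Type*) [Field L] [Algebra K L]
    (P : E.toAffine.Point) : ∃ (z : K) (T : ((C • E).baseChange L).toAffine.Point),
      addOrderOf T = addOrderOf P ∧ formalParam T = algebraMap K L z := by
  obtain ⟨Q, rfl⟩ := ofVariableChange_surjective C P
  rw [addOrderOf_injective _ (ofVariableChange_injective C)]
  -- `Affine.Point.map` acts between points of base changes, so the curve over `K` is first viewed
  -- as its own base change.
  have hK : (C • E).baseChange K = C • E := (C • E).map_id
  revert Q
  rw [← hK]
  intro Q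
  refine ⟨formalParam Q, Affine.Point.map (Algebra.ofId K L) Q,
    addOrderOf_injective _ (Affine.Point.map_injective _) Q, ?_⟩
  rcases Q with _ | ⟨x, y, h⟩
  · exact (map_zero (algebraMap K L)).symm
  · change -(algebraMap K L x) / algebraMap K L y = algebraMap K L (-x / y)
    rw [map_div₀, map_neg]

variable [NumberField K]

open scoped Classical in
lemma formalParam_mem_divisionField {m : ℕ}
    {T : ((C • E).baseChange (AlgebraicClosure K)).toAffine.Point} (hT : m • T = 0) :
    formalParam T ∈ divisionField E m := by
  have hE : (C • E).baseChange (AlgebraicClosure K) =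
      C.map (algebraMap K (AlgebraicClosure K)) • E.baseChange (AlgebraicClosure K) :=
    (E.map_variableChange C (algebraMap K (AlgebraicClosure K))).symm
  revert T
  rw [hE]
  intro T hT
  have hφ : ∀ a : K, algebraMap K (AlgebraicClosure K) a ∈ (divisionField E m).toSubfield :=
    fun a => (divisionField E m).algebraMap_mem a
  refine formalParam_mem_subfield (C.map (algebraMap K (AlgebraicClosure K)))
    (hφ _) (hφ _) (hφ _) (hφ _) fun X Y h e => ?_
  have hm : m • Affine.Point.some X Y h = 0 := by
    rw [← e, ← map_nsmul, hT, map_zero]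
  exact ⟨IntermediateField.subset_adjoin K _ ⟨X, Y, h, hm, Or.inl rfl⟩,
    IntermediateField.subset_adjoin K _ ⟨X, Y, h, hm, Or.inr rfl⟩⟩

open scoped Classical in
instance finiteDimensional_divisionField (m : ℕ) [NeZero m] :
    FiniteDimensional K (divisionField E m) := by
  have hfin := finite_torsion (E.baseChange (AlgebraicClosure K)) (NeZero.ne m)
  set S := {a | ∃ (x y : AlgebraicClosure K)
      (h : (E.baseChange (AlgebraicClosure K)).toAffine.Nonsingular x y),
      m • (WeierstrassCurve.Affine.Point.some x y h) = 0 ∧ (a = x ∨ a = y)} with hS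
  have : Finite S := by
    let f : Bool → (E.baseChange (AlgebraicClosure K)).toAffine.Point → AlgebraicClosure K :=
      fun b P => match b, P with
        | _, .zero => 0
        | true, .some x _ _ => x
        | false, .some _ y _ => y
    refine ((hfin.image (f true)).union (hfin.image (f false))).subset ?_
    rintro a ⟨x, y, h, hm, rfl | rfl⟩
    · exact Or.inl ⟨_, hm, rfl⟩
    · exact Or.inr ⟨_, hm, rfl⟩
  exact IntermediateField.finiteDimensional_adjoin
    fun x _ => (Algebra.IsAlgebraic.isAlgebraic x).isIntegral

end PointTransfer

end SupersingularTorsion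

/-! ### Ramification bounds. -/

namespace SupersingularTorsion

open WeierstrassCurve
open Affine.Point hiding map_zero neg_zero

variable {K : Type*} [Field K] [NumberField K] {E : WeierstrassCurve K} [E.IsElliptic]
  {C : VariableChange K} {𝔭 : HeightOneSpectrum (𝓞 K)} {p : ℕ}

instance numberField_divisionField (m : ℕ) [NeZero m] : NumberField (divisionField E m) :=
  NumberField.of_module_finite K _

/-- The valuation at `𝔓` restricts to `K` as a positive power of the valuation at `𝔭`, so any
extension of the former also extends the latter. -/
lemma exists_valuationSubring_of_liesOver {L : Type*} [Field L] [NumberField L] [Algebra K L]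
    {F : Type*} [Field F] [Algebra K F] [Algebra L F] [IsScalarTower K L F]
    (𝔓 : HeightOneSpectrum (𝓞 L)) [𝔓.asIdeal.LiesOver 𝔭.asIdeal] :
    ∃ A : ValuationSubring F, A.comap (algebraMap L F) = (𝔓.valuation L).valuationSubring ∧
      A.comap (algebraMap K F) = localRing 𝔭 := by
  obtain ⟨A, hA⟩ := exists_valuationSubring_comap_eq (L := F) (𝔓.valuation L).valuationSubring
  refine ⟨A, hA, ?_⟩
  rw [IsScalarTower.algebraMap_eq K L F, ← ValuationSubring.comap_comap, hA]
  ext x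
  rw [ValuationSubring.mem_comap, Valuation.mem_valuationSubring_iff,
    Valuation.mem_valuationSubring_iff, ← HeightOneSpectrum.valuation_liesOver L 𝔭 𝔓]
  exact pow_le_one_iff_of_nonneg zero_le
    (Ideal.IsDedekindDomain.ramificationIdx'_ne_zero_of_liesOver 𝔓.asIdeal 𝔭.ne_bot)

/-- The lower bounds for the ramification in the division field. -/
theorem ramificationIdx_divisionField (hp : p.Prime) (hp𝔭 : (p : 𝓞 K) ∈ 𝔭.asIdeal)
    (hC : HasSupersingularReduction (C • E) 𝔭 p) (m : ℕ)
    (𝔓 : Ideal (𝓞 (divisionField E (p ^ (m + 1))))) [𝔓.IsPrime] [𝔓.LiesOver 𝔭.asIdeal] :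
    (p ^ 2 - 1) * p ^ (2 * m) ≤ 𝔓.ramificationIdx ℤ ∧ (HasCanonicalSubgroup (C • E) 𝔭 p →
      (p ^ 2 - 1) * p ^ (2 * m) < 𝔓.ramificationIdx ℤ) := by
  classical
  have := Fact.mk hp
  have : NeZero (p ^ (m + 1)) := ⟨pow_ne_zero _ hp.ne_zero⟩
  have h𝔓0 : 𝔓 ≠ ⊥ := Ideal.ne_bot_of_liesOver_of_ne_bot 𝔭.ne_bot 𝔓
  let 𝔔 : HeightOneSpectrum (𝓞 (divisionField E (p ^ (m + 1)))) := ⟨𝔓, inferInstance, h𝔓0⟩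
  have : 𝔔.asIdeal.LiesOver 𝔭.asIdeal := ‹𝔓.LiesOver 𝔭.asIdeal›
  have hp𝔔 : (p : 𝓞 (divisionField E (p ^ (m + 1)))) ∈ 𝔔.asIdeal := by
    rw [← map_natCast (algebraMap (𝓞 K) (𝓞 (divisionField E (p ^ (m + 1))))), ← Ideal.mem_comap]
    rwa [𝔔.asIdeal.over_def 𝔭.asIdeal] at hp𝔭
  obtain ⟨A, hA, hAK⟩ := exists_valuationSubring_of_liesOver (K := K) (𝔭 := 𝔭)
    (F := AlgebraicClosure K) 𝔔
  have hss := hC.isSupersingularAt hp hp𝔭 hAK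
  obtain ⟨T, hT, hle, hlt⟩ := hss.exists_far_point m
  have hx := hss.one_lt_of_addOrderOf m.succ_ne_zero hT
  have hT0 : T ≠ 0 := by
    rintro rfl
    rw [addOrderOf_zero] at hT
    exact absurd hT (Nat.one_lt_pow m.succ_ne_zero hp.one_lt).ne
  have hf := valuation_formalParam hss.integral hT0 hx
  obtain ⟨z, hz⟩ : ∃ z : divisionField E (p ^ (m + 1)),
      algebraMap _ (AlgebraicClosure K) z = formalParam T :=
    ⟨⟨formalParam T, formalParam_mem_divisionField E C
      (by rw [← hT, addOrderOf_nsmul_eq_zero])⟩, rfl⟩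
  rw [← hz] at hf
  have hz1 : 𝔔.valuation _ z < 1 := by
    rw [← valuation_algebraMap_lt_one_iff hA]
    by_contra! h
    have : 1 < A.valuation (algebraMap _ (AlgebraicClosure K) z) ^ 2 * A.valuation (xCoord T) :=
      one_lt_mul_of_le_of_lt (one_le_pow₀ h) hx
    exact this.ne' hf
  have hz0 : z ≠ 0 := by
    rintro rfl
    rw [map_zero, map_zero] at hf
    simp at hf
  have e : A.valuation (p : AlgebraicClosure K) =
      A.valuation (algebraMap (divisionField E (p ^ (m + 1))) (AlgebraicClosure K) p) :=
    congrArg _ (map_natCast _ p).symm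
  rw [e] at hle hlt
  refine ⟨le_ramificationIdx hp hp𝔔 hz0 hz1 ?_, fun hcan => lt_ramificationIdx hp hp𝔔 hz0 hz1 ?_⟩
  · have := le_pow_of_mul_le_one hf hle
    rwa [← map_pow, ← map_pow, valuation_algebraMap_le_iff hA, map_pow] at this
  -- The canonical subgroup may have been found with another extension of the valuation; passing
  -- through `μ` moves it to the extension `A` chosen over `𝔔`.
  · rw [hasCanonicalSubgroup_iff_mu_lt hC hp hp𝔭,
      ← exists_isCanonicalSubgroup_iff_mu_lt hC hp hp𝔭 hAK,
      exists_isCanonicalSubgroup_iff hss] at hcan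
    have := lt_pow_of_mul_lt_one hf (hlt hcan)
    rwa [← map_pow, ← map_pow, valuation_algebraMap_lt_iff hA, map_pow] at this

/-- The constraints on the ramification of the base field imposed by a rational point. -/
theorem ramificationIdx_of_addOrderOf [DecidableEq K] (hp : p.Prime)
    (hp𝔭 : (p : 𝓞 K) ∈ 𝔭.asIdeal) (hC : HasSupersingularReduction (C • E) 𝔭 p) {m : ℕ}
    {P : E.toAffine.Point} (hP : addOrderOf P = p ^ (m + 1)) :
    (p - 1) * p ^ m < 𝔭.asIdeal.ramificationIdx ℤ ∧ (¬ HasCanonicalSubgroup (C • E) 𝔭 p →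
      (p ^ 2 - 1) * p ^ (2 * m) ∣ 𝔭.asIdeal.ramificationIdx ℤ) := by
  obtain ⟨A, hA⟩ := exists_valuationSubring_comap_eq (L := AlgebraicClosure K) (localRing 𝔭)
  have hss := hC.isSupersingularAt hp hp𝔭 hA
  obtain ⟨z, T, hT, hz⟩ := exists_formalParam_eq_algebraMap E C (AlgebraicClosure K) P
  rw [hP] at hT
  classical
  have hx := hss.one_lt_of_addOrderOf m.succ_ne_zero hT
  have hT0 : T ≠ 0 := by
    rintro rfl
    rw [addOrderOf_zero] at hT
    exact absurd hT (Nat.one_lt_pow m.succ_ne_zero hp.one_lt).ne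
  have hf := valuation_formalParam hss.integral hT0 hx
  rw [hz] at hf
  have hz1 : 𝔭.valuation K z < 1 := by
    rw [← valuation_algebraMap_lt_one_iff hA]
    by_contra! h
    have : 1 < A.valuation (algebraMap _ (AlgebraicClosure K) z) ^ 2 * A.valuation (xCoord T) :=
      one_lt_mul_of_le_of_lt (one_le_pow₀ h) hx
    exact this.ne' hf
  have hz0 : z ≠ 0 := by
    rintro rfl
    rw [map_zero, map_zero] at hf
    simp at hf
  have e : A.valuation (p : AlgebraicClosure K) =
      A.valuation (algebraMap K (AlgebraicClosure K) p) :=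
    congrArg _ (map_natCast _ p).symm
  refine ⟨lt_ramificationIdx hp hp𝔭 hz0 hz1 ?_, fun hcan => dvd_ramificationIdx hp hp𝔭 (z := z) ?_⟩
  · have := lt_pow_of_mul_lt_one hf (hss.valuation_pow_lt hT)
    rwa [e, ← map_pow, ← map_pow, valuation_algebraMap_lt_iff hA, map_pow] at this
  · rw [hasCanonicalSubgroup_iff_mu_lt hC hp hp𝔭,
      ← exists_isCanonicalSubgroup_iff_mu_lt hC hp hp𝔭 hA,
      exists_isCanonicalSubgroup_iff hss] at hcan
    push Not at hcan
    have := eq_pow_of_mul_eq_one hf (hss.valuation_pow_of_forall_eq hcan hT)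
    rw [e, ← map_pow, ← map_pow] at this
    rw [← map_pow]
    exact ((valuation_algebraMap_le_iff hA).mp this.le).antisymm
      ((valuation_algebraMap_le_iff hA).mp this.ge)

end SupersingularTorsion
end

theorem mainTheorem2 {K : Type*} [Field K] [NumberField K] [DecidableEq K]
    (E : WeierstrassCurve K) [E.IsElliptic]
    (p : ℕ) (hp : p.Prime) (n : ℕ) (hn : 1 ≤ n)
    (𝔭 : HeightOneSpectrum (𝓞 K)) (hp𝔭 : (p : 𝓞 K) ∈ 𝔭.asIdeal)
    (C : WeierstrassCurve.VariableChange K)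
    (hC : SupersingularTorsion.HasSupersingularReduction (C • E) 𝔭 p)
    (P : E.toAffine.Point) (hP : addOrderOf P = p ^ n) :
    (SupersingularTorsion.HasCanonicalSubgroup (C • E) 𝔭 p ↔
      SupersingularTorsion.mu (C • E) 𝔭 p < (((p : ℚ) / ((p : ℚ) + 1) : ℚ) : WithTop ℚ)) ∧
    (∀ 𝔓 : Ideal (𝓞 (SupersingularTorsion.divisionField E (p ^ n))),
      𝔓.IsPrime → 𝔓.LiesOver 𝔭.asIdeal →
        p ^ (2 * n) - p ^ (2 * n - 2) ≤ 𝔓.ramificationIdx ℤ) ∧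
    Nat.totient (p ^ n) < 𝔭.asIdeal.ramificationIdx ℤ ∧
    (¬ SupersingularTorsion.HasCanonicalSubgroup (C • E) 𝔭 p →
      p ^ (2 * n) - p ^ (2 * n - 2) ∣ 𝔭.asIdeal.ramificationIdx ℤ) ∧
    (SupersingularTorsion.HasCanonicalSubgroup (C • E) 𝔭 p →
      ∀ 𝔓 : Ideal (𝓞 (SupersingularTorsion.divisionField E (p ^ n))),
        𝔓.IsPrime → 𝔓.LiesOver 𝔭.asIdeal →
          p ^ (2 * n) - p ^ (2 * n - 2) < 𝔓.ramificationIdx ℤ) := by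
  obtain ⟨m, rfl⟩ : ∃ m, n = m + 1 := ⟨n - 1, by omega⟩
  have hN : p ^ (2 * (m + 1)) - p ^ (2 * (m + 1) - 2) = (p ^ 2 - 1) * p ^ (2 * m) := by
    rw [show 2 * (m + 1) - 2 = 2 * m by omega, Nat.sub_mul, one_mul, ← pow_add]
    congr 2
    ring
  obtain ⟨h₁, h₂⟩ := SupersingularTorsion.ramificationIdx_of_addOrderOf hp hp𝔭 hC hP
  rw [hN, Nat.totient_prime_pow_succ hp, mul_comm (p ^ m)]
  refine ⟨SupersingularTorsion.hasCanonicalSubgroup_iff_mu_lt hC hp hp𝔭, fun 𝔓 _ _ => ?_,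
    h₁, h₂, fun h 𝔓 _ _ => ?_⟩
  · exact (SupersingularTorsion.ramificationIdx_divisionField hp hp𝔭 hC m 𝔓).1
  · exact (SupersingularTorsion.ramificationIdx_divisionField hp hp𝔭 hC m 𝔓).2 h
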